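/- Let $k$ be a field of characteristic $0$ containing all roots of unity, with a fixed choice of primitive $m$-th roots of unity $\zeta_m\in k$ ($m\ge 1$) such that $\zeta_{m\ell}^{\ell}=\zeta_m$ for all $m,\ell\ge 1$. Let $R=k[t^{\pm1}]$ and $\widehat S=k[t^q\mid q\in\mathbb Q]$, regarded as commutative vertex rings through the iterative Hasse–Schmidt derivation $D_n=\frac1{n!}\left(\frac{d}{dt}\right)^n$, so that $Y(r,z)s=\sum_{n\ge0}D_n(r)s\,z^n$. Let $\widehat{\mathbb Z}$ be the profinite completion of $\mathbb Z$, acting on $\widehat S$ by $R$-linear automorphisms such that the topological generator $\hat 1$ acts by $t^{1/m}\mapsto\zeta_m t^{1/m}$ for all $m\ge1$; write $\gamma(s)$ for this action. An $R$-vertex algebra is a vertex ring $V$ with a homomorphism of vertex rings $\iota:R\to V$ whose image lies in the centre of $V$; it is an $R$-module via $rv=\iota(r)_{-1}v$. Let $V$ be such an algebra, with a filtration, i.e. an increasing family $(F_iV)_{i\in\mathbb Z}$ of $R$-submodules with $\bigcup_i F_iV=V$, $\mathbf 1\in F_0V$ and $(F_mV)_\ell(F_nV)\subset F_{m+n-\ell-1}V$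 (the trivial filtration $F_iV=V$ is allowed and gives the unfiltered case). For a commutative $R$-vertex algebra $T$, the base change $V\otimes_RT$ carries the products $(u\otimes s)_n(v\otimes s')=\sum_{j\ge0}u_{n+j}v\otimes D_j(s)s'$, the vacuum $\mathbf 1\otimes1$ and the filtration by the images of $F_iV\otimes_RT$, and $\mathbf{Aut}(V)(T)$ is the group of automorphisms of the filtered $T$-vertex algebra $V\otimes_RT$; it is functorial in $T$ by base change. The group $\widehat{\mathbb Z}$ acts on $\mathbf{Aut}(V)(\widehat S)$ by ${}^\gamma h=(\mathrm{id}\otimes\gamma)\,h\,(\mathrm{id}\otimes\gamma^{-1})$. Let $H^1(\widehat S/R,\mathbf{Aut}(V))$ be the pointed set of classes of $\varphi\in\mathbf{Aut}(V)(\widehat S\otimes_R\widehat S)$ with $p_{13}^*\varphi=p_{12}^*\varphi\; p_{23}^*\varphi$ in $\mathbf{Aut}(V)(\widehat S\otimes_R\widehat S\otimes_R\widehat S)$, modulo $\varphi\sim (p_1^*\lambda)^{-1}\,\varphi\;p_2^*\lambda$ for $\lambda\in\mathbf{Aut}(V)(\widehat S)$, where $p_{ij}^*$ and $p_i^*$ are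 induced by the inclusions of the indicated tensor factors. Let $H^1_{\mathrm{ct}}(\widehat{\mathbb Z},A)$, for a discrete group $A$ with $\widehat{\mathbb Z}$-action, be the pointed set of continuous maps $c:\widehat{\mathbb Z}\to A$ with $c(\gamma\gamma')=c(\gamma)\,{}^{\gamma}c(\gamma')$, modulo $c\sim(\gamma\mapsto a^{-1}c(\gamma)\,{}^\gamma a)$ for $a\in A$. **Theorem.** Suppose that $V$ is finitely generated as an $R$-vertex algebra. Then: a) The action of the profinite group $\widehat{\mathbb Z}$ on the discrete group $\mathbf{Aut}(V)(\widehat S)$ is continuous. b) There is a bijection of pointed sets $H^1(\widehat S/R,\mathbf{Aut}(V))\simeq H^1_{\mathrm{ct}}(\widehat{\mathbb Z},\mathbf{Aut}(V)(\widehat S))$. It is the canonical one: it sends the class of a cocycle $\varphi$ to the class of the continuous cocycle $\gamma\mapsto\mathbf{Aut}(V)(\varepsilon_\gamma)(\varphi)$, where $\varepsilon_\gamma:\widehat S\otimes_R\widehat S\to\widehat S$, $a\otimes b\mapsto a\,\gamma(b)$. -/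

import Mathlib

open scoped TensorProduct

noncomputable section

set_option linter.unusedSectionVars false

/-- An iterative Hasse-Schmidt derivation on a commutative ring. A commutative vertex ring is the
same thing as a commutative ring with such a structure. -/
class HasseSchmidt (S : Type*) [CommRing S] where
  D : ℕ → S →+ S
  D_zero : ∀ a, D 0 a = a
  D_mul : ∀ n a b, D n (a * b) = ∑ p ∈ Finset.HasAntidiagonal.antidiagonal n, D p.1 a * D p.2 b
  D_D : ∀ i j a, D i (D j a) = (i + j).choose i • D (i + j) a

namespace HasseSchmidt

variable {S : Type*} [CommRing S] [HasseSchmidt S]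

/-- The generating series `∑ D_n(a) z ^ n`. -/
def series (a : S) : PowerSeries S := PowerSeries.mk fun n => D n a

@[simp] theorem coeff_series (n : ℕ) (a : S) : PowerSeries.coeff n (series a) = D n a :=
  PowerSeries.coeff_mk _ _

theorem series_mul (a b : S) : series (a * b) = series a * series b := by
  ext n
  simp [PowerSeries.coeff_mul, D_mul]

theorem series_one : series (1 : S) = 1 := by
  have h : series (1 : S) * series (1 : S) = series (1 : S) := by rw [← series_mul, one_mul]
  have hu : IsUnit (series (1 : S)) := by
    rw [PowerSeries.isUnit_iff_constantCoeff, ← PowerSeries.coeff_zero_eq_constantCoeff_apply,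
      coeff_series, D_zero]
    exact isUnit_one
  exact hu.mul_left_cancel (by rw [h, mul_one])

theorem D_one (n : ℕ) : D n (1 : S) = if n = 0 then 1 else 0 := by
  rw [← coeff_series, series_one, PowerSeries.coeff_one]

/-- The `n`-th product of the commutative vertex ring attached to `S`:
`Y(r, z) s = ∑ m ≥ 0, D_m(r) s z ^ m`. -/
def nprod (n : ℤ) (r s : S) : S :=
  match n with
  | Int.ofNat _ => 0
  | Int.negSucc m => D m r * s

/-- On a `ℚ`-algebra, a derivation `d` gives the Hasse-Schmidt derivation `d ^ n / n !`. -/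
@[reducible] def ofDerivation {A : Type*} [CommRing A] [Algebra ℚ A] (d : Derivation ℚ A A) :
    HasseSchmidt A where
  D n := (((n.factorial : ℚ)⁻¹ • (d : A →ₗ[ℚ] A) ^ n : A →ₗ[ℚ] A) : A →+ A)
  D_zero a := by simp
  D_mul n a b := by
    have hd : ∀ m x, ((d : A →ₗ[ℚ] A) ^ (m + 1)) x = d (((d : A →ₗ[ℚ] A) ^ m) x) := fun m x => by
      rw [pow_succ', Module.End.mul_apply]; rfl
    have key : ∀ n, ((d : A →ₗ[ℚ] A) ^ n) (a * b) =
        ∑ p ∈ Finset.HasAntidiagonal.antidiagonal n,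
        n.choose p.1 • (((d : A →ₗ[ℚ] A) ^ p.1) a * ((d : A →ₗ[ℚ] A) ^ p.2) b) := by
      intro n
      induction n with
      | zero => simp
      | succ n ih =>
        rw [Finset.sum_antidiagonal_choose_succ_nsmul (M := A)
          (fun i j => ((d : A →ₗ[ℚ] A) ^ i) a * ((d : A →ₗ[ℚ] A) ^ j) b) n, hd, ih, map_sum,
          ← Finset.sum_add_distrib]
        refine Finset.sum_congr rfl fun p hp => ?_
        rw [map_nsmul, Derivation.leibniz, hd, hd, nsmul_add, smul_eq_mul, smul_eq_mul,
          mul_comm (((d : A →ₗ[ℚ] A) ^ p.2) b)]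
        rw [Nat.choose_symm_of_eq_add (Finset.HasAntidiagonal.mem_antidiagonal.1 hp).symm]
    change ((n.factorial : ℚ)⁻¹ • (d : A →ₗ[ℚ] A) ^ n) (a * b) =
      ∑ p ∈ Finset.HasAntidiagonal.antidiagonal n,
        ((p.1.factorial : ℚ)⁻¹ • (d : A →ₗ[ℚ] A) ^ p.1) a *
        ((p.2.factorial : ℚ)⁻¹ • (d : A →ₗ[ℚ] A) ^ p.2) b
    rw [LinearMap.smul_apply, key, Finset.smul_sum]
    refine Finset.sum_congr rfl fun p hp => ?_
    obtain ⟨i, j⟩ := p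
    obtain rfl : i + j = n := Finset.HasAntidiagonal.mem_antidiagonal.1 hp
    rw [LinearMap.smul_apply, LinearMap.smul_apply, smul_mul_smul_comm,
      ← Nat.cast_smul_eq_nsmul ℚ, smul_smul]
    congr 1
    have h2 : ((i+j).choose i : ℚ) * i.factorial * j.factorial = (i+j).factorial := by
      exact_mod_cast Nat.choose_symm_add (a := i) (b := j) ▸ Nat.add_choose_mul_factorial_mul_factorial i j
    field_simp
    linarith
  D_D i j a := by
    change ((i.factorial : ℚ)⁻¹ • (d : A →ₗ[ℚ] A) ^ i) (((j.factorial : ℚ)⁻¹ •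
      (d : A →ₗ[ℚ] A) ^ j) a) = (i + j).choose i • (((i + j).factorial : ℚ)⁻¹ •
      (d : A →ₗ[ℚ] A) ^ (i + j)) a
    rw [LinearMap.smul_apply, LinearMap.smul_apply, LinearMap.smul_apply, map_smul, smul_smul]
    rw [← Module.End.mul_apply, ← pow_add, ← Nat.cast_smul_eq_nsmul ℚ, smul_smul]
    congr 1
    have h2 : ((i+j).choose i : ℚ) * i.factorial * j.factorial = (i+j).factorial := by
      exact_mod_cast Nat.choose_symm_add (a := i) (b := j) ▸ Nat.add_choose_mul_factorial_mul_factorial i j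
    field_simp
    linarith

end HasseSchmidt

/-- A commutative `R`-vertex algebra: an algebra whose structure map commutes with the
Hasse-Schmidt derivations. -/
class HSAlgebra (R S : Type*) [CommRing R] [HasseSchmidt R] [CommRing S] [HasseSchmidt S]
    [Algebra R S] : Prop where
  D_algebraMap : ∀ n r, HasseSchmidt.D n (algebraMap R S r) = algebraMap R S (HasseSchmidt.D n r)

/-- Homomorphisms of commutative `R`-vertex algebras. -/
structure HSHom (R S T : Type*) [CommRing R] [CommRing S] [HasseSchmidt S] [Algebra R S]
    [CommRing T] [HasseSchmidt T] [Algebra R T] extends S →ₐ[R] T where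
  map_D : ∀ n s, toAlgHom (HasseSchmidt.D n s) = HasseSchmidt.D n (toAlgHom s)

namespace HSHom

variable {R S T U : Type*} [CommRing R] [CommRing S] [HasseSchmidt S] [Algebra R S]
  [CommRing T] [HasseSchmidt T] [Algebra R T] [CommRing U] [HasseSchmidt U] [Algebra R U]

def id (R S : Type*) [CommRing R] [CommRing S] [HasseSchmidt S] [Algebra R S] : HSHom R S S where
  toAlgHom := AlgHom.id R S
  map_D _ _ := rfl

def comp (g : HSHom R T U) (f : HSHom R S T) : HSHom R S U where
  toAlgHom := g.toAlgHom.comp f.toAlgHom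
  map_D n s := by simp [f.map_D, g.map_D]

end HSHom

section TensorHS

open HasseSchmidt

variable (R A B : Type*) [CommRing R] [HasseSchmidt R]
  [CommRing A] [HasseSchmidt A] [Algebra R A] [HSAlgebra R A]
  [CommRing B] [HasseSchmidt B] [Algebra R B] [HSAlgebra R B]

theorem D_smul {R A : Type*} [CommRing R] [HasseSchmidt R]
    [CommRing A] [HasseSchmidt A] [Algebra R A] [HSAlgebra R A] (n : ℕ) (r : R) (a : A) :
    D n (r • a) = ∑ p ∈ Finset.HasAntidiagonal.antidiagonal n, D p.1 r • D p.2 a := by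
  simp [Algebra.smul_def, D_mul, HSAlgebra.D_algebraMap]

theorem series_algebraMap {R A : Type*} [CommRing R] [HasseSchmidt R]
    [CommRing A] [HasseSchmidt A] [Algebra R A] [HSAlgebra R A] (r : R) :
    series (algebraMap R A r) = PowerSeries.map (algebraMap R A) (series r) := by
  ext n
  simp [HSAlgebra.D_algebraMap]

theorem coeff_tensorSeries (n : ℕ) (a : A) (b : B) :
    PowerSeries.coeff n
      (PowerSeries.map (Algebra.TensorProduct.includeLeft : A →ₐ[R] A ⊗[R] B).toRingHom (series a) *
       PowerSeries.map (Algebra.TensorProduct.includeRight : B →ₐ[R] A ⊗[R] B).toRingHom (series b))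
      = ∑ p ∈ Finset.HasAntidiagonal.antidiagonal n, D p.1 a ⊗ₜ[R] D p.2 b := by
  simp [PowerSeries.coeff_mul]

theorem tensorAlg : (Algebra.TensorProduct.includeLeft : A →ₐ[R] A ⊗[R] B).toRingHom.comp
    (algebraMap R A) = (Algebra.TensorProduct.includeRight : B →ₐ[R] A ⊗[R] B).toRingHom.comp
    (algebraMap R B) := by
  ext r
  simp

/-- `D_n (a ⊗ b) = ∑_{i + j = n} D_i a ⊗ D_j b`. -/
def tensorD (n : ℕ) : A ⊗[R] B →+ A ⊗[R] B :=
  TensorProduct.liftAddHom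
    (AddMonoidHom.mk' (fun a => AddMonoidHom.mk' (fun b =>
      ∑ p ∈ Finset.HasAntidiagonal.antidiagonal n, D p.1 a ⊗ₜ[R] D p.2 b)
      (fun b b' => by simp [TensorProduct.tmul_add, Finset.sum_add_distrib]))
      (fun a a' => by ext b; simp [TensorProduct.add_tmul, Finset.sum_add_distrib]))
    (fun r a b => by
      simp only [AddMonoidHom.mk'_apply, ← coeff_tensorSeries, Algebra.smul_def, series_mul,
        map_mul, series_algebraMap]
      congr 1
      rw [← RingHom.comp_apply, ← RingHom.comp_apply, ← PowerSeries.map_comp,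
        ← PowerSeries.map_comp, tensorAlg]
      ring)

@[simp] theorem tensorD_tmul (n : ℕ) (a : A) (b : B) :
    tensorD R A B n (a ⊗ₜ b) = ∑ p ∈ Finset.HasAntidiagonal.antidiagonal n, D p.1 a ⊗ₜ[R] D p.2 b := rfl

instance : HasseSchmidt (A ⊗[R] B) where
  D := tensorD R A B
  D_zero x := by
    induction x with
    | zero => simp
    | add x y hx hy => simp [hx, hy]
    | tmul a b => simp [D_zero]
  D_mul n x y := by
    induction x with
    | zero => simp
    | add x x' hx hx' => simp [hx, hx', add_mul, Finset.sum_add_distrib]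
    | tmul a b =>
      induction y with
      | zero => simp
      | add y y' hy hy' => simp [hy, hy', mul_add, Finset.sum_add_distrib]
      | tmul a' b' =>
        have hc := coeff_tensorSeries R A B
        simp only [Algebra.TensorProduct.tmul_mul_tmul, tensorD_tmul, ← hc, series_mul, map_mul]
        rw [← PowerSeries.coeff_mul]
        congr 1
        ring
  D_D i j x := by
    induction x with
    | zero => simp
    | add x x' hx hx' => simp only [map_add, hx, hx', smul_add]
    | tmul a b =>
      simp only [tensorD_tmul, map_sum, D_D]
      rw [Finset.smul_sum, Finset.sum_comm]
      have hV : ∀ s ∈ Finset.HasAntidiagonal.antidiagonal (i + j),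
          (i + j).choose i • (D s.1 a ⊗ₜ[R] D s.2 b) =
          ∑ q ∈ Finset.HasAntidiagonal.antidiagonal i,
            (s.1.choose q.1 * s.2.choose q.2) • (D s.1 a ⊗ₜ[R] D s.2 b) := by
        intro s hs
        rw [← Finset.sum_smul, ← Nat.add_choose_eq, Finset.HasAntidiagonal.mem_antidiagonal.1 hs]
      rw [Finset.sum_congr rfl hV, Finset.sum_comm (t := Finset.HasAntidiagonal.antidiagonal i)]
      refine Finset.sum_congr rfl fun q hq => ?_
      have hq' := Finset.HasAntidiagonal.mem_antidiagonal.1 hq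
      refine Finset.sum_of_injOn (fun p => (q.1 + p.1, q.2 + p.2)) ?_ ?_ ?_ ?_
      · rintro ⟨x, y⟩ - ⟨x', y'⟩ - h
        simpa using h
      · rintro ⟨x, y⟩ h
        simp only [Finset.mem_coe, Finset.HasAntidiagonal.mem_antidiagonal] at h ⊢
        omega
      · rintro ⟨x, y⟩ h hn
        simp only [Set.mem_image, Finset.mem_coe, Finset.HasAntidiagonal.mem_antidiagonal, Prod.mk.injEq,
          Prod.exists, not_exists, not_and] at h hn
        by_cases hx : x < q.1
        · simp [Nat.choose_eq_zero_of_lt hx]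
        by_cases hy : y < q.2
        · simp [Nat.choose_eq_zero_of_lt hy]
        exact absurd (by omega) (hn (x - q.1) (y - q.2) (by omega) (by omega))
      · rintro ⟨x, y⟩ h
        simp only [← TensorProduct.smul_tmul', TensorProduct.tmul_smul, smul_smul]
        rw [mul_comm]

theorem D_tmul (n : ℕ) (a : A) (b : B) : D n (a ⊗ₜ[R] b) =
    ∑ p ∈ Finset.HasAntidiagonal.antidiagonal n, D p.1 a ⊗ₜ[R] D p.2 b := rfl

end TensorHS

section TensorHom

open HasseSchmidt

variable {R A B C : Type*} [CommRing R] [HasseSchmidt R]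
  [CommRing A] [HasseSchmidt A] [Algebra R A] [HSAlgebra R A]
  [CommRing B] [HasseSchmidt B] [Algebra R B] [HSAlgebra R B]
  [CommRing C] [HasseSchmidt C] [Algebra R C]

theorem D_tmul_one (n : ℕ) (a : A) : D n (a ⊗ₜ[R] (1 : B)) = D n a ⊗ₜ[R] (1 : B) := by
  rw [D_tmul, Finset.sum_eq_single (n, 0)]
  · simp [D_zero]
  · rintro ⟨i, j⟩ h hne
    have h' := Finset.HasAntidiagonal.mem_antidiagonal.1 h
    have : j ≠ 0 := by
      rintro rfl
      exact hne (by simpa using h')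
    simp [D_one, this]
  · simp

theorem D_one_tmul (n : ℕ) (b : B) : D n ((1 : A) ⊗ₜ[R] b) = (1 : A) ⊗ₜ[R] D n b := by
  rw [D_tmul, Finset.sum_eq_single (0, n)]
  · simp [D_zero]
  · rintro ⟨i, j⟩ h hne
    have h' := Finset.HasAntidiagonal.mem_antidiagonal.1 h
    have : i ≠ 0 := by
      rintro rfl
      exact hne (by simpa using h')
    simp [D_one, this]
  · simp

instance : HSAlgebra R (A ⊗[R] B) where
  D_algebraMap n r := by
    rw [Algebra.TensorProduct.algebraMap_apply, D_tmul_one, HSAlgebra.D_algebraMap]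
    rfl

namespace HSHom

variable (R A B) in
/-- `a ↦ a ⊗ 1`. -/
def inl : HSHom R A (A ⊗[R] B) where
  toAlgHom := Algebra.TensorProduct.includeLeft
  map_D n a := (D_tmul_one n a).symm

variable (R A B) in
/-- `b ↦ 1 ⊗ b`. -/
def inr : HSHom R B (A ⊗[R] B) where
  toAlgHom := Algebra.TensorProduct.includeRight
  map_D n b := (D_one_tmul n b).symm

/-- `a ⊗ b ↦ f a * g b`. -/
def productMap (f : HSHom R A C) (g : HSHom R B C) : HSHom R (A ⊗[R] B) C where
  toAlgHom := Algebra.TensorProduct.productMap f.toAlgHom g.toAlgHom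
  map_D n x := by
    induction x with
    | zero => simp
    | add x y hx hy => simp only [map_add, hx, hy]
    | tmul a b => simp [D_tmul, D_mul, f.map_D, g.map_D]

end HSHom

end TensorHom

/-- The data of a vertex ring: a vacuum vector and biadditive `n`-th products `u_n v`, for `n : ℤ`. -/
class NProducts (V : Type*) [AddCommGroup V] where
  vac : V
  nprod : ℤ → V →+ V →+ V

open NProducts

/-- Vertex rings. The Jacobi identity is stated in components (Borcherds identity);
all sums in it are finite by regularity. -/
class VertexRing (V : Type*) [AddCommGroup V] extends NProducts V where
  regular : ∀ u v : V, ∃ N : ℤ, ∀ n : ℤ, N ≤ n → nprod n u v = 0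
  creation_neg_one : ∀ v : V, nprod (-1) v vac = v
  creation_nonneg : ∀ (v : V) (n : ℤ), 0 ≤ n → nprod n v vac = 0
  jacobi : ∀ (u v w : V) (l m n : ℤ),
    ∑ᶠ i : ℕ, (Ring.choose m i : ℤ) • nprod (m + n - i) (nprod (l + i) u v) w =
    ∑ᶠ i : ℕ, ((-1) ^ i * Ring.choose l i : ℤ) •
      (nprod (m + l - i) u (nprod (n + i) v w) -
        (l.negOnePow : ℤ) • nprod (n + l - i) v (nprod (m + i) u w))

/-- An `R`-vertex algebra over the commutative vertex ring `R`: a vertex ring `V` with a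
homomorphism of vertex rings `ι : R → V` whose image lies in the centre of `V`. -/
class VertexAlgebra (R V : Type*) [CommRing R] [HasseSchmidt R] [AddCommGroup V]
    [VertexRing V] where
  ι : R →+ V
  ι_one : ι 1 = vac
  ι_nprod : ∀ (n : ℤ) (r s : R), ι (HasseSchmidt.nprod n r s) = nprod n (ι r) (ι s)
  central : ∀ (r : R) (v : V) (n : ℤ), 0 ≤ n → nprod n (ι r) v = 0 ∧ nprod n v (ι r) = 0

namespace VertexAlgebra

section VR

variable {V : Type*} [AddCommGroup V] [VertexRing V]

/-- The commutator formula for a pair of vectors with vanishing nonnegative products. -/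
theorem nprod_comm (u v w : V) (h : ∀ n : ℤ, 0 ≤ n → nprod n u v = 0) (m n : ℤ) :
    nprod m u (nprod n v w) = nprod n v (nprod m u w) := by
  have hj := VertexRing.jacobi u v w 0 m n
  rw [finsum_eq_zero_of_forall_eq_zero, finsum_eq_single _ 0] at hj
  · simpa [sub_eq_zero] using hj.symm
  · intro i hi
    obtain ⟨i, rfl⟩ := Nat.exists_eq_succ_of_ne_zero hi
    simp [Ring.choose_zero_succ]
  · intro i
    rw [h (0 + i) (by omega)]
    simp

theorem vac_nprod_nonneg (v : V) (n : ℤ) (hn : 0 ≤ n) : nprod n vac v = 0 := by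
  have h := nprod_comm v vac vac (fun n hn => VertexRing.creation_nonneg v n hn) (-1) n
  rw [VertexRing.creation_neg_one, VertexRing.creation_nonneg _ n hn, map_zero] at h
  exact h.symm

theorem vac_nprod_neg_one (v : V) : nprod (-1) vac v = v := by
  have h := nprod_comm v vac vac (fun n hn => VertexRing.creation_nonneg v n hn) (-1) (-1)
  rw [VertexRing.creation_neg_one, VertexRing.creation_neg_one] at h
  exact h.symm

/-- The associativity formula when `u` kills `w` under nonnegative products. -/
theorem nprod_assoc (u v w : V) (h : ∀ n : ℤ, 0 ≤ n → nprod n u w = 0) (l n : ℤ) :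
    nprod n (nprod l u v) w =
    ∑ᶠ i : ℕ, ((-1) ^ i * Ring.choose l i : ℤ) • nprod (l - i) u (nprod (n + i) v w) := by
  have hj := VertexRing.jacobi u v w l 0 n
  rw [finsum_eq_single _ 0] at hj
  · simpa [h] using hj
  · intro i hi
    obtain ⟨i, rfl⟩ := Nat.exists_eq_succ_of_ne_zero hi
    simp [Ring.choose_zero_succ]

end VR

variable {R V : Type*} [CommRing R] [HasseSchmidt R] [AddCommGroup V] [VertexRing V]
  [VertexAlgebra R V]

theorem ι_D_nprod (i : ℕ) (r : R) (w : V) :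
    nprod (-1) (ι (HasseSchmidt.D i r)) w = nprod (-1 - i) (ι r) w := by
  have h : (ι (HasseSchmidt.D i r) : V) = nprod (-1 - i) (ι r) vac := by
    have := ι_nprod (V := V) (-1 - i) r 1
    rw [ι_one] at this
    rw [← this, show (-1 - i : ℤ) = Int.negSucc i by rw [Int.negSucc_eq]; ring]
    simp [HasseSchmidt.nprod]
  rw [h, nprod_assoc _ _ _ (fun n hn => (central r w n hn).1), finsum_eq_single _ 0]
  · simp [vac_nprod_neg_one]
  · intro j hj
    rw [vac_nprod_nonneg _ _ (by omega)]
    simp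

/-- The `R`-module structure `r • v = ι(r)_{-1} v` of an `R`-vertex algebra. -/
instance toModule : Module R V where
  smul r v := nprod (-1) (ι r) v
  one_smul v := by
    change nprod (-1) (ι (1 : R)) v = v
    rw [ι_one, vac_nprod_neg_one]
  mul_smul r s v := by
    change nprod (-1) (ι (r * s)) v = nprod (-1) (ι r) (nprod (-1) (ι s) v)
    have h : (ι (r * s) : V) = nprod (-1) (ι r) (ι s) := by
      rw [← ι_nprod, show (-1 : ℤ) = Int.negSucc 0 from rfl]
      simp [HasseSchmidt.nprod, HasseSchmidt.D_zero]
    rw [h, nprod_assoc _ _ _ (fun n hn => (central r v n hn).1), finsum_eq_single _ 0]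
    · simp
    · intro j hj
      rw [(central s v (-1 + j) (by omega)).1]
      simp
  smul_zero r := map_zero _
  smul_add r v w := map_add _ _ _
  add_smul r s v := by
    change nprod (-1) (ι (r + s)) v = nprod (-1) (ι r) v + nprod (-1) (ι s) v
    simp
  zero_smul v := by
    change nprod (-1) (ι (0 : R)) v = 0
    simp

theorem smul_def (r : R) (v : V) : r • v = nprod (-1) (ι r) v := rfl

theorem nprod_smul (n : ℤ) (r : R) (u v : V) : nprod n u (r • v) = r • nprod n u v := by
  rw [smul_def, smul_def]
  exact nprod_comm u (ι r) v (fun n hn => (central r u n hn).2) n (-1)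

theorem smul_nprod (n : ℤ) (r : R) (u v : V) :
    nprod n (r • u) v = ∑ᶠ i : ℕ, HasseSchmidt.D i r • nprod (n + i) u v := by
  rw [smul_def, nprod_assoc _ _ _ (fun n hn => (central r v n hn).1)]
  refine finsum_congr fun i => ?_
  rw [smul_def, ι_D_nprod]
  have : ((-1) ^ i * Ring.choose (-1 : ℤ) i : ℤ) = 1 := by
    rw [Ring.choose_neg', Ring.multichoose_one, Int.negOnePow_def, zpow_natCast, Units.smul_def,
      Units.val_pow_eq_pow_val, smul_eq_mul, mul_one, ← mul_pow]
    simp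
  rw [this, one_smul]

end VertexAlgebra

/-- `V` is finitely generated as an `R`-vertex algebra: some finite subset is contained in no proper
`R`-vertex subalgebra. -/
def VertexAlgebra.FinitelyGenerated (R V : Type*) [CommRing R] [HasseSchmidt R] [AddCommGroup V]
    [VertexRing V] [VertexAlgebra R V] : Prop :=
  ∃ s : Finset V, ∀ W : Submodule R V, vac ∈ W →
    (∀ (n : ℤ) (u v : V), u ∈ W → v ∈ W → nprod n u v ∈ W) → (s : Set V) ⊆ W → W = ⊤

/-- Filtrations of an `R`-vertex algebra. An `R`-vertex algebra without filtration is the case of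
the trivial filtration `F_i V = V`. -/
structure VertexFiltration (R V : Type*) [CommRing R] [HasseSchmidt R] [AddCommGroup V]
    [VertexRing V] [VertexAlgebra R V] where
  F : ℤ → Submodule R V
  mono : Monotone F
  exhaustive : ∀ v, ∃ i, v ∈ F i
  vac_mem : vac ∈ F 0
  nprod_mem : ∀ (m n l : ℤ) (u v : V), u ∈ F m → v ∈ F n → nprod l u v ∈ F (n + m - l - 1)

namespace BaseChange

open HasseSchmidt

variable {R V : Type*} [CommRing R] [HasseSchmidt R] [AddCommGroup V] [VertexRing V]
  [VertexAlgebra R V]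
variable {T : Type*} [CommRing T] [HasseSchmidt T] [Algebra R T]

theorem nat_regular (n : ℤ) (u v : V) : ∃ N : ℕ, ∀ j : ℕ, N ≤ j → nprod (n + j) u v = 0 := by
  obtain ⟨N, hN⟩ := VertexRing.regular u v
  exact ⟨(N - n).toNat, fun j hj => hN _ (by omega)⟩

theorem finsum_range {M : Type*} [AddCommMonoid M] {f : ℕ → M} {N : ℕ}
    (h : ∀ j, N ≤ j → f j = 0) : ∑ᶠ j, f j = ∑ j ∈ Finset.range N, f j := by
  refine finsum_eq_sum_of_support_subset _ fun j hj => ?_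
  by_contra hn
  exact hj (h j (by simpa using hn))

theorem finsum_antidiagonal {M : Type*} [AddCommMonoid M] (f : ℕ → ℕ → M) (N : ℕ)
    (h : ∀ i j, N ≤ i + j → f i j = 0) :
    ∑ᶠ m, ∑ p ∈ Finset.HasAntidiagonal.antidiagonal m, f p.1 p.2 = ∑ᶠ i, ∑ᶠ j, f i j := by
  have h1 : ∀ i, ∑ᶠ j, f i j = ∑ j ∈ Finset.range N, f i j := fun i =>
    finsum_range fun j hj => h i j (by omega)
  rw [finsum_range (N := N), finsum_range (N := N)]
  · simp_rw [h1]
    rw [Finset.sum_sigma', ← Finset.sum_product' (f := f)]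
    refine Finset.sum_of_injOn (fun p => p.2) ?_ ?_ ?_ ?_
    · rintro ⟨m, i, j⟩ hm ⟨m', i', j'⟩ hm' h
      simp at hm hm' h
      obtain ⟨rfl, rfl⟩ := h
      obtain ⟨-, rfl⟩ := hm
      obtain ⟨-, rfl⟩ := hm'
      rfl
    · rintro ⟨m, i, j⟩ hm
      simp at hm ⊢
      omega
    · rintro ⟨i, j⟩ hij hn
      refine h i j ?_
      by_contra hlt
      exact hn ⟨⟨i + j, i, j⟩, by simpa using hlt, rfl⟩
    · intros; rfl
  · intro i hi
    rw [h1]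
    exact Finset.sum_eq_zero fun j _ => h i j (by omega)
  · intro m hm
    refine Finset.sum_eq_zero fun p hp => h _ _ ?_
    rw [Finset.HasAntidiagonal.mem_antidiagonal.1 hp]
    exact hm

theorem support_finite {M : Type*} [AddCommMonoid M] {f : ℕ → M} (N : ℕ)
    (h : ∀ j, N ≤ j → f j = 0) : (Function.support f).Finite :=
  (Finset.range N).finite_toSet.subset fun j hj => by
    by_contra hn
    exact hj (h j (by simpa using hn))

variable (R) in
/-- The formula `(s ⊗ u)_n (t ⊗ v) = ∑ j ≥ 0, D_j(s) t ⊗ u_{n + j} v`. -/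
def prodFormula (n : ℤ) (s : T) (u : V) (t : T) (v : V) : T ⊗[R] V :=
  ∑ᶠ j : ℕ, (D j s * t) ⊗ₜ[R] nprod (n + j) u v

theorem term_finite (n : ℤ) (s : T) (u : V) (t : T) (v : V) :
    (Function.support fun j : ℕ => (D j s * t) ⊗ₜ[R] nprod (n + j) u v).Finite := by
  obtain ⟨N, hN⟩ := nat_regular n u v
  exact support_finite N fun j hj => by simp [hN j hj]

variable (R) in
/-- `y ↦ (s ⊗ u)_n y`, as a `T`-linear map. -/
def prodLeft (n : ℤ) (s : T) (u : V) : T ⊗[R] V →ₗ[T] T ⊗[R] V :=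
  LinearMap.liftBaseChange T
    { toFun := fun v => prodFormula R n s u 1 v
      map_add' := fun v v' => by
        simp only [prodFormula, map_add, TensorProduct.tmul_add]
        exact finsum_add_distrib (term_finite n s u 1 v) (term_finite n s u 1 v')
      map_smul' := fun r v => by
        simp only [prodFormula, VertexAlgebra.nprod_smul, TensorProduct.tmul_smul]
        exact (smul_finsum' r (term_finite n s u 1 v)).symm }

theorem prodLeft_tmul (n : ℤ) (s : T) (u : V) (t : T) (v : V) :
    prodLeft R n s u (t ⊗ₜ[R] v) = prodFormula R n s u t v := by
  change t • prodFormula R n s u 1 v = _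
  rw [prodFormula, smul_finsum' t (term_finite n s u 1 v)]
  refine finsum_congr fun j => ?_
  rw [TensorProduct.smul_tmul', smul_eq_mul, mul_one, mul_comm]

theorem prodFormula_smul [HSAlgebra R T] (n : ℤ) (r : R) (s : T) (u : V) (t : T) (v : V) :
    prodFormula R n (r • s) u t v = prodFormula R n s (r • u) t v := by
  obtain ⟨N, hN⟩ := nat_regular n u v
  simp only [prodFormula]
  have h1 : ∀ j : ℕ, (D j (r • s) * t) ⊗ₜ[R] nprod (n + j) u v =
      ∑ p ∈ Finset.HasAntidiagonal.antidiagonal j,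
        (D p.2 s * t) ⊗ₜ[R] (D p.1 r • nprod (n + p.2 + p.1) u v) := by
    intro j
    rw [D_smul, Finset.sum_mul, TensorProduct.sum_tmul]
    refine Finset.sum_congr rfl fun p hp => ?_
    rw [smul_mul_assoc, TensorProduct.smul_tmul,
      ← Finset.HasAntidiagonal.mem_antidiagonal.1 hp]
    congr 4
    push_cast
    ring_nf
  have h2 : ∀ j : ℕ, (D j s * t) ⊗ₜ[R] nprod (n + j) (r • u) v =
      ∑ᶠ i : ℕ, (D j s * t) ⊗ₜ[R] (D i r • nprod (n + j + i) u v) := by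
    intro j
    rw [VertexAlgebra.smul_nprod]
    obtain ⟨N', hN'⟩ := nat_regular (n + j) u v
    rw [finsum_range (N := N') (fun i hi => by rw [hN' i hi, smul_zero]), TensorProduct.tmul_sum,
      finsum_range (N := N') (fun i hi => by rw [hN' i hi, smul_zero, TensorProduct.tmul_zero])]
  simp_rw [h1, h2]
  rw [finsum_antidiagonal (fun i j => (D j s * t) ⊗ₜ[R] (D i r • nprod (n + j + i) u v)) N,
    ← finsum_antidiagonal (fun j i => (D j s * t) ⊗ₜ[R] (D i r • nprod (n + j + i) u v)) N,
    ← finsum_antidiagonal (fun i j => (D j s * t) ⊗ₜ[R] (D i r • nprod (n + j + i) u v)) N]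
  · refine finsum_congr fun m => ?_
    rw [← Finset.Nat.sum_antidiagonal_swap]
    rfl
  all_goals
    intro i j hij
    have := hN (i + j) hij
    push_cast at this
    first
      | rw [show n + (i : ℤ) + j = n + (i + j) by ring, this, smul_zero, TensorProduct.tmul_zero]
      | rw [show n + (j : ℤ) + i = n + (i + j) by ring, this, smul_zero, TensorProduct.tmul_zero]

/-- The `n`-th product on `T ⊗ V`. -/
def prod [HSAlgebra R T] (n : ℤ) : T ⊗[R] V →+ (T ⊗[R] V →ₗ[T] T ⊗[R] V) :=
  TensorProduct.liftAddHom
    { toFun := fun s : T =>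
        { toFun := fun u : V => prodLeft R n s u
          map_zero' := by
            refine TensorProduct.AlgebraTensorModule.ext fun t v => ?_
            rw [prodLeft_tmul]
            simp [prodFormula]
          map_add' := fun u u' => by
            refine TensorProduct.AlgebraTensorModule.ext fun t v => ?_
            rw [LinearMap.add_apply, prodLeft_tmul, prodLeft_tmul, prodLeft_tmul]
            simp only [prodFormula, map_add, AddMonoidHom.add_apply, TensorProduct.tmul_add]
            exact finsum_add_distrib (term_finite n s u t v) (term_finite n s u' t v) }
      map_zero' := by
        ext1 u
        refine TensorProduct.AlgebraTensorModule.ext fun t v => ?_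
        change prodLeft R n (0 : T) u _ = 0
        rw [prodLeft_tmul]
        simp [prodFormula]
      map_add' := fun s s' => by
        ext1 u
        refine TensorProduct.AlgebraTensorModule.ext fun t v => ?_
        change prodLeft R n (s + s') u _ = prodLeft R n s u _ + prodLeft R n s' u _
        rw [prodLeft_tmul, prodLeft_tmul, prodLeft_tmul]
        simp only [prodFormula, map_add, add_mul, TensorProduct.add_tmul]
        exact finsum_add_distrib (term_finite n s u t v) (term_finite n s' u t v) }
    (fun r s u => by
      refine TensorProduct.AlgebraTensorModule.ext fun t v => ?_
      change prodLeft R n (r • s) u _ = prodLeft R n s (r • u) _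
      rw [prodLeft_tmul, prodLeft_tmul, prodFormula_smul])

theorem prod_tmul [HSAlgebra R T] (n : ℤ) (s : T) (u : V) (t : T) (v : V) :
    prod n (s ⊗ₜ[R] u) (t ⊗ₜ[R] v) = prodFormula R n s u t v :=
  prodLeft_tmul n s u t v

/-- The base change of an `R`-vertex algebra `V` to a commutative `R`-vertex algebra `T`, with the
products `(s ⊗ u)_n (t ⊗ v) = ∑ j ≥ 0, D_j(s) t ⊗ u_{n + j} v` and the vacuum `1 ⊗ vac`; the
structure map is `t ↦ t ⊗ vac`. We write the factor `T` on the left. -/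
instance [HSAlgebra R T] : NProducts (T ⊗[R] V) where
  vac := 1 ⊗ₜ vac
  nprod n := AddMonoidHom.mk' (fun x => (prod n x).toAddMonoidHom)
    (fun x y => by ext z; simp)

variable [HSAlgebra R T]

theorem vac_def : (vac : T ⊗[R] V) = 1 ⊗ₜ vac := rfl

theorem nprod_eq (n : ℤ) (x y : T ⊗[R] V) : nprod n x y = prod n x y := rfl

theorem nprod_tmul (n : ℤ) (s : T) (u : V) (t : T) (v : V) :
    nprod n (s ⊗ₜ[R] u) (t ⊗ₜ[R] v) = ∑ᶠ j : ℕ, (D j s * t) ⊗ₜ[R] nprod (n + j) u v :=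
  prod_tmul n s u t v

theorem nprod_smul (n : ℤ) (t : T) (x y : T ⊗[R] V) :
    nprod n x (t • y) = t • nprod n x y := map_smul (prod n x) t y

theorem regular (x y : T ⊗[R] V) : ∃ N : ℤ, ∀ n : ℤ, N ≤ n → nprod n x y = 0 := by
  induction x with
  | zero => exact ⟨0, fun n _ => by simp⟩
  | add x x' hx hx' =>
    obtain ⟨N, hN⟩ := hx
    obtain ⟨N', hN'⟩ := hx'
    exact ⟨max N N', fun n hn => by
      simp [hN n (le_trans (le_max_left _ _) hn), hN' n (le_trans (le_max_right _ _) hn)]⟩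
  | tmul s u =>
    induction y with
    | zero => exact ⟨0, fun n _ => by simp⟩
    | add x x' hx hx' =>
      obtain ⟨N, hN⟩ := hx
      obtain ⟨N', hN'⟩ := hx'
      exact ⟨max N N', fun n hn => by
        simp [hN n (le_trans (le_max_left _ _) hn), hN' n (le_trans (le_max_right _ _) hn)]⟩
    | tmul t v =>
      obtain ⟨N, hN⟩ := VertexRing.regular u v
      refine ⟨N, fun n hn => ?_⟩
      rw [nprod_tmul]
      exact finsum_eq_zero_of_forall_eq_zero fun j => by rw [hN _ (by omega), TensorProduct.tmul_zero]

/-- The structure map `t ↦ t ⊗ vac` induces the `T`-module structure: `(t ⊗ vac)_{-1} x = t • x`. -/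
theorem structure_nprod (t : T) (x : T ⊗[R] V) : nprod (-1) (t ⊗ₜ[R] (vac : V)) x = t • x := by
  induction x with
  | zero => simp
  | add x y hx hy => simp [hx, hy]
  | tmul s v =>
    rw [nprod_tmul, finsum_eq_single _ 0]
    · simp [VertexAlgebra.vac_nprod_neg_one, D_zero, TensorProduct.smul_tmul']
    · intro j hj
      rw [VertexAlgebra.vac_nprod_nonneg _ _ (by omega), TensorProduct.tmul_zero]

theorem smul_nprod (n : ℤ) (s : T) (x y : T ⊗[R] V) :
    nprod n (s • x) y = ∑ᶠ i : ℕ, D i s • nprod (n + i) x y := by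
  have hfin : ∀ x y : T ⊗[R] V,
      (Function.support fun i : ℕ => D i s • nprod (n + i) x y).Finite := by
    intro x y
    obtain ⟨N, hN⟩ := regular x y
    exact support_finite (N - n).toNat fun j hj => by rw [hN _ (by omega), smul_zero]
  induction x with
  | zero => simp
  | add x x' hx hx' =>
    simp only [smul_add, map_add, AddMonoidHom.add_apply, hx, hx']
    exact (finsum_add_distrib (hfin x y) (hfin x' y)).symm
  | tmul t u =>
    induction y with
    | zero => simp
    | add y y' hy hy' =>
      simp only [smul_add, map_add, hy, hy']
      exact (finsum_add_distrib (hfin _ y) (hfin _ y')).symm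
    | tmul t' v =>
      obtain ⟨N, hN⟩ := nat_regular n u v
      rw [TensorProduct.smul_tmul', smul_eq_mul, nprod_tmul]
      have h1 : ∀ j : ℕ, (D j (s * t) * t') ⊗ₜ[R] nprod (n + j) u v =
          ∑ p ∈ Finset.HasAntidiagonal.antidiagonal j,
            D p.1 s • ((D p.2 t * t') ⊗ₜ[R] nprod (n + p.1 + p.2) u v) := by
        intro j
        rw [D_mul, Finset.sum_mul, TensorProduct.sum_tmul]
        refine Finset.sum_congr rfl fun p hp => ?_
        rw [TensorProduct.smul_tmul', smul_eq_mul, mul_assoc,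
          ← Finset.HasAntidiagonal.mem_antidiagonal.1 hp]
        congr 3
        push_cast
        ring_nf
      simp_rw [h1]
      rw [finsum_antidiagonal
        (fun i j => D i s • ((D j t * t') ⊗ₜ[R] nprod (n + i + j) u v)) N]
      · refine finsum_congr fun i => ?_
        rw [nprod_tmul, smul_finsum' _ (term_finite _ t u t' v)]
      · intro i j hij
        have := hN (i + j) hij
        push_cast at this
        rw [show n + (i : ℤ) + j = n + (i + j) by ring, this, TensorProduct.tmul_zero, smul_zero]

end BaseChange

section Aut

variable {R V : Type*} [CommRing R] [HasseSchmidt R] [AddCommGroup V] [VertexRing V]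
  [VertexAlgebra R V]

/-- The automorphisms of the filtered `T`-vertex algebra `T ⊗ V`: the `T`-linear bijections that
preserve all `n`-th products and the vacuum, and preserve the filtration (by the images of the
`T ⊗ F_i V`) in both directions. Since `(t ⊗ vac)_{-1} x = t • x`, being `T`-linear is the same,
for such bijections, as commuting with the structure map `t ↦ t ⊗ vac`. -/
def autSubgroup (𝓕 : VertexFiltration R V) (T : Type*) [CommRing T] [HasseSchmidt T] [Algebra R T]
    [HSAlgebra R T] : Subgroup ((T ⊗[R] V) ≃ₗ[T] (T ⊗[R] V)) where
  carrier := {e | (∀ (n : ℤ) (x y : T ⊗[R] V), e (nprod n x y) = nprod n (e x) (e y)) ∧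
    e vac = vac ∧ ∀ (i : ℤ) (x : T ⊗[R] V),
      e x ∈ (𝓕.F i).baseChange T ↔ x ∈ (𝓕.F i).baseChange T}
  one_mem' := ⟨fun _ _ _ => rfl, rfl, fun _ _ => Iff.rfl⟩
  mul_mem' := by
    rintro e f ⟨h1, h2, h3⟩ ⟨h1', h2', h3'⟩
    refine ⟨fun n x y => ?_, ?_, fun i x => ?_⟩
    · simp only [LinearEquiv.mul_apply, h1, h1']
    · simp only [LinearEquiv.mul_apply, h2, h2']
    · simp only [LinearEquiv.mul_apply, h3, h3']
  inv_mem' := by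
    rintro e ⟨h1, h2, h3⟩
    refine ⟨fun n x y => ?_, ?_, fun i x => ?_⟩
    · apply e.injective
      rw [h1]
      simp only [← LinearEquiv.mul_apply, mul_inv_cancel]
      rfl
    · apply e.injective
      rw [h2]
      simp only [← LinearEquiv.mul_apply, mul_inv_cancel]
      rfl
    · rw [← h3]
      simp only [← LinearEquiv.mul_apply, mul_inv_cancel]
      exact Iff.rfl

/-- The group `Aut(V)(T)`. -/
def VAut (𝓕 : VertexFiltration R V) (T : Type*) [CommRing T] [HasseSchmidt T] [Algebra R T]
    [HSAlgebra R T] : Type _ := autSubgroup 𝓕 T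

variable (𝓕 : VertexFiltration R V)

instance (T : Type*) [CommRing T] [HasseSchmidt T] [Algebra R T] [HSAlgebra R T] :
    Group (VAut 𝓕 T) := inferInstanceAs (Group (autSubgroup 𝓕 T))

/-- The groups `Aut(V)(T)` are discrete. -/
instance (T : Type*) [CommRing T] [HasseSchmidt T] [Algebra R T] [HSAlgebra R T] :
    TopologicalSpace (VAut 𝓕 T) := ⊥

namespace VAut

variable {𝓕}
variable {T U W : Type*} [CommRing T] [HasseSchmidt T] [Algebra R T] [HSAlgebra R T]
  [CommRing U] [HasseSchmidt U] [Algebra R U] [HSAlgebra R U]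
  [CommRing W] [HasseSchmidt W] [Algebra R W] [HSAlgebra R W]

/-- The underlying linear bijection of `T ⊗ V`. -/
def equiv (h : VAut 𝓕 T) : (T ⊗[R] V) ≃ₗ[T] (T ⊗[R] V) := h.1

theorem ext {h h' : VAut 𝓕 T} (H : ∀ x, h.equiv x = h'.equiv x) : h = h' :=
  Subtype.ext (LinearEquiv.ext H)

theorem mul_equiv (h h' : VAut 𝓕 T) (x : T ⊗[R] V) :
    (h * h').equiv x = h.equiv (h'.equiv x) := rfl

theorem one_equiv (x : T ⊗[R] V) : (1 : VAut 𝓕 T).equiv x = x := rfl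

variable (V) in
/-- The map `f ⊗ id : T ⊗ V → U ⊗ V`. -/
def push (f : HSHom R T U) : T ⊗[R] V →ₗ[R] U ⊗[R] V := f.toAlgHom.toLinearMap.rTensor V

@[simp] theorem push_tmul (f : HSHom R T U) (t : T) (v : V) :
    push V f (t ⊗ₜ v) = f.toAlgHom t ⊗ₜ v := rfl

theorem push_smul (f : HSHom R T U) (t : T) (x : T ⊗[R] V) :
    push V f (t • x) = f.toAlgHom t • push V f x := by
  induction x with
  | zero => simp
  | add x y hx hy => simp [hx, hy]
  | tmul s v => simp [TensorProduct.smul_tmul']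

theorem push_vac (f : HSHom R T U) : push V f vac = vac := by
  simp [BaseChange.vac_def]

theorem push_nprod (f : HSHom R T U) (n : ℤ) (x y : T ⊗[R] V) :
    push V f (nprod n x y) = nprod n (push V f x) (push V f y) := by
  induction x with
  | zero => simp
  | add x x' hx hx' => simp [hx, hx']
  | tmul s u =>
    induction y with
    | zero => simp
    | add y y' hy hy' => simp only [map_add, hy, hy']
    | tmul t v =>
      rw [BaseChange.nprod_tmul, push_tmul, push_tmul, BaseChange.nprod_tmul]
      obtain ⟨N, hN⟩ := BaseChange.nat_regular n u v
      rw [BaseChange.finsum_range (N := N) fun j hj => by rw [hN j hj, TensorProduct.tmul_zero],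
        BaseChange.finsum_range (N := N) fun j hj => by rw [hN j hj, TensorProduct.tmul_zero],
        map_sum]
      refine Finset.sum_congr rfl fun j _ => ?_
      rw [push_tmul, map_mul, f.map_D]

theorem push_mem (f : HSHom R T U) (i : ℤ) (x : T ⊗[R] V) (hx : x ∈ (𝓕.F i).baseChange T) :
    push V f x ∈ (𝓕.F i).baseChange U := by
  rw [Submodule.baseChange_eq_span] at hx
  induction hx using Submodule.span_induction with
  | mem x hx =>
    obtain ⟨v, hv, rfl⟩ := hx
    exact Submodule.tmul_mem_baseChange_of_mem _ hv
  | zero => simp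
  | add x y _ _ hx hy => rw [map_add]; exact add_mem hx hy
  | smul t x _ hx => rw [push_smul]; exact Submodule.smul_mem _ _ hx

/-- The `U`-linear map `U ⊗ V → U ⊗ V` obtained from `h` by base change along `f`. -/
def mapLin (f : HSHom R T U) (h : VAut 𝓕 T) : U ⊗[R] V →ₗ[U] U ⊗[R] V :=
  LinearMap.liftBaseChange U
    ((push V f ∘ₗ (h.equiv : T ⊗[R] V →ₗ[T] T ⊗[R] V).restrictScalars R) ∘ₗ
      TensorProduct.mk R T V 1)

theorem mapLin_tmul (f : HSHom R T U) (h : VAut 𝓕 T) (u : U) (v : V) :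
    mapLin f h (u ⊗ₜ v) = u • push V f (h.equiv (1 ⊗ₜ v)) := rfl

theorem mapLin_push (f : HSHom R T U) (h : VAut 𝓕 T) (x : T ⊗[R] V) :
    mapLin f h (push V f x) = push V f (h.equiv x) := by
  induction x with
  | zero => simp
  | add x y hx hy => simp only [map_add, hx, hy]
  | tmul t v =>
    rw [push_tmul, mapLin_tmul, ← push_smul, ← map_smul, TensorProduct.smul_tmul', smul_eq_mul,
      mul_one]

theorem lin_ext {g g' : U ⊗[R] V →ₗ[U] U ⊗[R] V} (f : HSHom R T U)
    (H : ∀ x : T ⊗[R] V, g (push V f x) = g' (push V f x)) : g = g' := by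
  refine TensorProduct.AlgebraTensorModule.ext fun u v => ?_
  have : u ⊗ₜ[R] v = u • push V f (1 ⊗ₜ v) := by simp [TensorProduct.smul_tmul']
  rw [this, map_smul, map_smul, H]

theorem mapLin_mul (f : HSHom R T U) (h h' : VAut 𝓕 T) (x : U ⊗[R] V) :
    mapLin f (h * h') x = mapLin f h (mapLin f h' x) := by
  have : mapLin f (h * h') = mapLin f h ∘ₗ mapLin f h' := by
    refine lin_ext f fun x => ?_
    rw [LinearMap.comp_apply, mapLin_push, mapLin_push, mapLin_push, mul_equiv]
  rw [this, LinearMap.comp_apply]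

theorem mapLin_one (f : HSHom R T U) (x : U ⊗[R] V) : mapLin f (1 : VAut 𝓕 T) x = x := by
  have : mapLin f (1 : VAut 𝓕 T) = LinearMap.id := by
    refine lin_ext f fun x => ?_
    rw [mapLin_push, one_equiv, LinearMap.id_apply]
  rw [this, LinearMap.id_apply]

theorem mapLin_nprod (f : HSHom R T U) (h : VAut 𝓕 T) (n : ℤ) (x y : U ⊗[R] V) :
    mapLin f h (nprod n x y) = nprod n (mapLin f h x) (mapLin f h y) := by
  have key : ∀ (n : ℤ) (u v : V), mapLin f h (nprod n (1 ⊗ₜ u) (1 ⊗ₜ v)) =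
      nprod n (mapLin f h (1 ⊗ₜ u)) (mapLin f h (1 ⊗ₜ v)) := by
    intro n u v
    have h1 : ∀ v : V, (1 : U) ⊗ₜ[R] v = push V f (1 ⊗ₜ v) := by simp
    rw [h1, h1, ← push_nprod, mapLin_push, mapLin_push, mapLin_push, ← push_nprod, equiv, h.2.1]
  induction x with
  | zero => simp
  | add x x' hx hx' => simp [hx, hx']
  | tmul s u =>
    induction y with
    | zero => simp
    | add y y' hy hy' => simp only [map_add, hy, hy']
    | tmul t v =>
      have hs : s ⊗ₜ[R] u = s • (1 : U) ⊗ₜ[R] u := by simp [TensorProduct.smul_tmul']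
      have ht : t ⊗ₜ[R] v = t • (1 : U) ⊗ₜ[R] v := by simp [TensorProduct.smul_tmul']
      simp only [hs, ht, LinearMap.map_smul, BaseChange.nprod_smul, BaseChange.smul_nprod]
      obtain ⟨N, hN⟩ := BaseChange.regular ((1 : U) ⊗ₜ[R] u) ((1 : U) ⊗ₜ[R] v)
      have hN' : ∀ j : ℕ, (N - n).toNat ≤ j →
          nprod (n + j) ((1 : U) ⊗ₜ[R] u) ((1 : U) ⊗ₜ[R] v) = 0 := fun j hj => hN _ (by omega)
      rw [BaseChange.finsum_range (N := (N - n).toNat) fun j hj => by rw [hN' j hj, smul_zero],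
        BaseChange.finsum_range (N := (N - n).toNat) fun j hj => by
          rw [← key, hN' j hj, map_zero, smul_zero], map_sum]
      congr 1
      refine Finset.sum_congr rfl fun j _ => ?_
      rw [map_smul, key]

theorem mapLin_mem (f : HSHom R T U) (h : VAut 𝓕 T) (i : ℤ) (x : U ⊗[R] V)
    (hx : x ∈ (𝓕.F i).baseChange U) : mapLin f h x ∈ (𝓕.F i).baseChange U := by
  rw [Submodule.baseChange_eq_span] at hx
  induction hx using Submodule.span_induction with
  | mem x hx =>
    obtain ⟨v, hv, rfl⟩ := hx
    rw [TensorProduct.mk_apply, mapLin_tmul, one_smul]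
    exact push_mem f i _ ((h.2.2.2 i _).2 (Submodule.tmul_mem_baseChange_of_mem _ hv))
  | zero => simp
  | add x y _ _ hx hy => rw [map_add]; exact add_mem hx hy
  | smul t x _ hx => rw [map_smul]; exact Submodule.smul_mem _ _ hx

/-- The base change of an automorphism. -/
def mapEquiv (f : HSHom R T U) (h : VAut 𝓕 T) : (U ⊗[R] V) ≃ₗ[U] (U ⊗[R] V) where
  __ := mapLin f h
  invFun := mapLin f h⁻¹
  left_inv x := by
    change mapLin f h⁻¹ (mapLin f h x) = x
    rw [← mapLin_mul, inv_mul_cancel, mapLin_one]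
  right_inv x := by
    change mapLin f h (mapLin f h⁻¹ x) = x
    rw [← mapLin_mul, mul_inv_cancel, mapLin_one]

/-- Functoriality of `Aut(V)`: for `f : T → U`, the automorphism `h` of `T ⊗ V` is sent to the
`U`-linear extension of `v ↦ (f ⊗ id) (h (1 ⊗ v))`, i.e. to its base change along `f`. -/
def map (f : HSHom R T U) : VAut 𝓕 T →* VAut 𝓕 U where
  toFun h := ⟨mapEquiv f h, fun n x y => mapLin_nprod f h n x y, by
    change mapLin f h vac = vac
    rw [← push_vac f, mapLin_push]
    exact congrArg _ h.2.2.1, fun i x => by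
    refine ⟨fun hx => ?_, fun hx => mapLin_mem f h i x hx⟩
    have := mapLin_mem f h⁻¹ i _ hx
    change mapLin f h⁻¹ (mapLin f h x) ∈ _ at this
    rwa [← mapLin_mul, inv_mul_cancel, mapLin_one] at this⟩
  map_one' := ext fun x => mapLin_one f x
  map_mul' h h' := ext fun x => mapLin_mul f h h' x

theorem map_equiv_push (f : HSHom R T U) (h : VAut 𝓕 T) (x : T ⊗[R] V) :
    (map f h).equiv (push V f x) = push V f (h.equiv x) := mapLin_push f h x

theorem map_unique (f : HSHom R T U) (h : VAut 𝓕 T) (g : VAut 𝓕 U)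
    (H : ∀ x, g.equiv (push V f x) = push V f (h.equiv x)) : g = map f h := by
  have : (g.equiv : U ⊗[R] V →ₗ[U] U ⊗[R] V) = mapLin f h :=
    lin_ext f fun x => by rw [mapLin_push]; exact H x
  exact ext fun x => LinearMap.congr_fun this x

theorem push_id (x : T ⊗[R] V) : push V (HSHom.id R T) x = x := by
  induction x with
  | zero => simp
  | add x y hx hy => simp [hx, hy]
  | tmul s v => rfl

theorem push_comp (g : HSHom R U W) (f : HSHom R T U) (x : T ⊗[R] V) :
    push V (g.comp f) x = push V g (push V f x) := by
  induction x with
  | zero => simp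
  | add x y hx hy => simp [hx, hy]
  | tmul s v => rfl

theorem map_id (h : VAut 𝓕 T) : map (HSHom.id R T) h = h :=
  (map_unique _ _ _ fun x => by rw [push_id, push_id]).symm

theorem map_comp (g : HSHom R U W) (f : HSHom R T U) (h : VAut 𝓕 T) :
    map (g.comp f) h = map g (map f h) :=
  (map_unique _ _ _ fun x => by
    rw [push_comp, map_equiv_push, map_equiv_push, push_comp]).symm

end VAut

end Aut

/-! ### Flat cohomology -/

section FlatH1

variable {R V : Type*} [CommRing R] [HasseSchmidt R] [AddCommGroup V] [VertexRing V]
  [VertexAlgebra R V] (𝓕 : VertexFiltration R V)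
  (S : Type*) [CommRing S] [HasseSchmidt S] [Algebra R S] [HSAlgebra R S]

/-- `a ⊗ b ↦ a ⊗ b ⊗ 1`. -/
def p12 (R S : Type*) [CommRing R] [HasseSchmidt R] [CommRing S] [HasseSchmidt S] [Algebra R S]
    [HSAlgebra R S] : HSHom R (S ⊗[R] S) ((S ⊗[R] S) ⊗[R] S) :=
  HSHom.inl R (S ⊗[R] S) S

/-- `a ⊗ b ↦ a ⊗ 1 ⊗ b`. -/
def p13 (R S : Type*) [CommRing R] [HasseSchmidt R] [CommRing S] [HasseSchmidt S] [Algebra R S]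
    [HSAlgebra R S] : HSHom R (S ⊗[R] S) ((S ⊗[R] S) ⊗[R] S) :=
  HSHom.productMap ((HSHom.inl R (S ⊗[R] S) S).comp (HSHom.inl R S S)) (HSHom.inr R (S ⊗[R] S) S)

/-- `a ⊗ b ↦ 1 ⊗ a ⊗ b`. -/
def p23 (R S : Type*) [CommRing R] [HasseSchmidt R] [CommRing S] [HasseSchmidt S] [Algebra R S]
    [HSAlgebra R S] : HSHom R (S ⊗[R] S) ((S ⊗[R] S) ⊗[R] S) :=
  HSHom.productMap ((HSHom.inl R (S ⊗[R] S) S).comp (HSHom.inr R S S)) (HSHom.inr R (S ⊗[R] S) S)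

/-- The cocycles `Z¹(S/R, Aut(V))`. -/
def FlatZ1 : Type _ := {φ : VAut 𝓕 (S ⊗[R] S) //
  VAut.map (p13 R S) φ = VAut.map (p12 R S) φ * VAut.map (p23 R S) φ}

/-- The trivial cocycle. -/
instance : One (FlatZ1 𝓕 S) := ⟨⟨1, by simp⟩⟩

/-- Two cocycles `φ, φ'` are cohomologous if `φ' = p₁^*(λ)⁻¹ φ p₂^*(λ)` for some `λ ∈ Aut(V)(S)`. -/
def flatSetoid : Setoid (FlatZ1 𝓕 S) where
  r φ φ' := ∃ a : VAut 𝓕 S,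
    φ'.1 = (VAut.map (HSHom.inl R S S) a)⁻¹ * φ.1 * VAut.map (HSHom.inr R S S) a
  iseqv := {
    refl φ := ⟨1, by simp⟩
    symm := by
      rintro φ φ' ⟨a, h⟩
      exact ⟨a⁻¹, by rw [h]; simp [mul_assoc]⟩
    trans := by
      rintro φ φ' φ'' ⟨a, h⟩ ⟨b, h'⟩
      exact ⟨a * b, by rw [h', h]; simp [mul_assoc]⟩ }

/-- The pointed set `H¹(S/R, Aut(V))`. -/
def FlatH1 : Type _ := Quotient (flatSetoid 𝓕 S)

/-- The class of a cocycle. -/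
def FlatH1.mk (φ : FlatZ1 𝓕 S) : FlatH1 𝓕 S := Quotient.mk (flatSetoid 𝓕 S) φ

end FlatH1

/-! ### Continuous nonabelian cohomology -/

section ContH1

variable {G A : Type*} [Group G] [TopologicalSpace G] [Group A] [TopologicalSpace A]

/-- Continuous 1-cocycles of `G` with values in the group `A` on which `G` acts through `ρ`. -/
def ContZ1 (ρ : G →* MulAut A) : Type _ :=
  {c : G → A // Continuous c ∧ ∀ g h, c (g * h) = c g * ρ g (c h)}

/-- The trivial cocycle. -/
instance (ρ : G →* MulAut A) : One (ContZ1 ρ) := ⟨⟨fun _ => 1, continuous_const, by simp⟩⟩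

/-- Cohomologous cocycles: `c' g = a⁻¹ c(g) ᵍa` for some `a ∈ A`. -/
def contSetoid (ρ : G →* MulAut A) : Setoid (ContZ1 ρ) where
  r c c' := ∃ a : A, ∀ g, c'.1 g = a⁻¹ * c.1 g * ρ g a
  iseqv := {
    refl c := ⟨1, by simp⟩
    symm := by
      rintro c c' ⟨a, h⟩
      exact ⟨a⁻¹, fun g => by rw [h]; simp [mul_assoc]⟩
    trans := by
      rintro c c' c'' ⟨a, h⟩ ⟨b, h'⟩
      exact ⟨a * b, fun g => by rw [h', h]; simp [mul_assoc]⟩ }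

/-- The pointed set of continuous cohomology classes `H¹_ct(G, A)`. -/
def ContH1 (ρ : G →* MulAut A) : Type _ := Quotient (contSetoid ρ)

/-- The class of a cocycle. -/
def ContH1.mk (ρ : G →* MulAut A) (c : ContZ1 ρ) : ContH1 ρ := Quotient.mk (contSetoid ρ) c

end ContH1

/-! ### Laurent polynomials with integral and with rational exponents -/

section Rings

variable (k : Type*) [Field k] [CharZero k]

/-- The `k`-linear map `t ^ q ↦ c(q) t ^ (q - 1)`, which is the derivation `d/dt`
when `c(q) = q` in `k`. -/
def ddtLin {Γ : Type*} [CommRing Γ] (c : Γ →+* k) :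
    AddMonoidAlgebra k Γ →ₗ[k] AddMonoidAlgebra k Γ :=
  (AddMonoidAlgebra.coeffLinearEquiv k).symm.toLinearMap ∘ₗ
    (Finsupp.lsum k fun q : Γ => c q • Finsupp.lsingle (q - 1)) ∘ₗ
    (AddMonoidAlgebra.coeffLinearEquiv k).toLinearMap

theorem ddtLin_single {Γ : Type*} [CommRing Γ] (c : Γ →+* k) (q : Γ) (a : k) :
    ddtLin k c (AddMonoidAlgebra.single q a) = AddMonoidAlgebra.single (q - 1) (c q * a) := by
  simp only [ddtLin, LinearMap.comp_apply, LinearEquiv.coe_coe]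
  rw [show AddMonoidAlgebra.coeffLinearEquiv k (AddMonoidAlgebra.single q a) = Finsupp.single q a
    from rfl, Finsupp.lsum_single, LinearMap.smul_apply, Finsupp.lsingle_apply, Finsupp.smul_single,
    smul_eq_mul]
  rfl

/-- The derivation `d/dt`. -/
def ddt {Γ : Type*} [CommRing Γ] (c : Γ →+* k) :
    Derivation k (AddMonoidAlgebra k Γ) (AddMonoidAlgebra k Γ) :=
  Derivation.mk' (ddtLin k c) fun x y => by
    induction x using AddMonoidAlgebra.induction_linear with
    | zero => simp
    | add x x' hx hx' =>
      rw [add_mul, map_add, map_add, hx, hx', add_smul, smul_add]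
      abel
    | single p a =>
      induction y using AddMonoidAlgebra.induction_linear with
      | zero => simp
      | add y y' hy hy' =>
        rw [mul_add, map_add, map_add, hy, hy', add_smul, smul_add]
        abel
      | single q b =>
        rw [AddMonoidAlgebra.single_mul_single, ddtLin_single, ddtLin_single, ddtLin_single,
          smul_eq_mul, smul_eq_mul, AddMonoidAlgebra.single_mul_single,
          AddMonoidAlgebra.single_mul_single, show p + (q - 1) = p + q - 1 by ring,
          show q + (p - 1) = p + q - 1 by ring, ← AddMonoidAlgebra.single_add, map_add]
        congr 1
        ring

/-- `R = k[t, t⁻¹]`. -/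
abbrev LaurentRing : Type _ := AddMonoidAlgebra k ℤ

/-- `Ŝ = k[t ^ q | q ∈ ℚ]`. -/
abbrev SHat : Type _ := AddMonoidAlgebra k ℚ

/-- `R = k[t, t⁻¹]` with the Hasse-Schmidt derivation `(d/dt) ^ n / n !`. -/
instance : HasseSchmidt (LaurentRing k) :=
  HasseSchmidt.ofDerivation ((ddt k (Int.castRingHom k)).restrictScalars ℚ)

/-- `Ŝ` with the Hasse-Schmidt derivation `(d/dt) ^ n / n !`. -/
instance : HasseSchmidt (SHat k) :=
  HasseSchmidt.ofDerivation ((ddt k (algebraMap ℚ k)).restrictScalars ℚ)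

/-- The inclusion `R → Ŝ`. -/
instance : Algebra (LaurentRing k) (SHat k) :=
  (AddMonoidAlgebra.mapDomainRingHom k (Int.castAddHom ℚ)).toAlgebra

theorem algebraMap_single (n : ℤ) (a : k) :
    algebraMap (LaurentRing k) (SHat k) (AddMonoidAlgebra.single n a) =
      AddMonoidAlgebra.single (n : ℚ) a :=
  AddMonoidAlgebra.mapDomain_single ..

/-- A ring homomorphism commuting with the derivations commutes with the Hasse-Schmidt derivations. -/
theorem map_ofDerivation {A B : Type*} [CommRing A] [Algebra ℚ A] [CommRing B] [Algebra ℚ B]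
    (d : Derivation ℚ A A) (d' : Derivation ℚ B B) (f : A →+* B) (h : ∀ a, f (d a) = d' (f a))
    (n : ℕ) (a : A) :
    f ((HasseSchmidt.ofDerivation d).D n a) = (HasseSchmidt.ofDerivation d').D n (f a) := by
  change f ((n.factorial : ℚ)⁻¹ • ((d : A →ₗ[ℚ] A) ^ n) a) =
    (n.factorial : ℚ)⁻¹ • ((d' : B →ₗ[ℚ] B) ^ n) (f a)
  rw [map_rat_smul]
  congr 1
  induction n generalizing a with
  | zero => rfl
  | succ n ih =>
    rw [pow_succ, pow_succ, Module.End.mul_apply, Module.End.mul_apply, ih]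
    exact congrArg _ (h a)

instance : HSAlgebra (LaurentRing k) (SHat k) where
  D_algebraMap n r := by
    refine (map_ofDerivation ((ddt k (Int.castRingHom k)).restrictScalars ℚ)
      ((ddt k (algebraMap ℚ k)).restrictScalars ℚ) (algebraMap (LaurentRing k) (SHat k))
      (fun x => ?_) n r).symm
    change algebraMap (LaurentRing k) (SHat k) (ddtLin k _ x) = ddtLin k _ (algebraMap _ (SHat k) x)
    induction x using AddMonoidAlgebra.induction_linear with
    | zero => simp
    | add x x' hx hx' => simp only [map_add, hx, hx']
    | single n a =>
      rw [ddtLin_single, algebraMap_single, algebraMap_single, ddtLin_single]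
      simp only [eq_intCast, Int.cast_sub, Int.cast_one, map_intCast]

end Rings

/-! ### The action of the profinite completion of `ℤ` -/

/-- The profinite completion of `ℤ`, written multiplicatively. -/
abbrev ZHat : ProfiniteGrp.{0} :=
  ProfiniteGrp.ProfiniteCompletion.completion (GrpCat.of (Multiplicative ℤ))

namespace ZHat

/-- The topological generator `1` of the profinite completion of `ℤ`. -/
def gen : ZHat :=
  ProfiniteGrp.ProfiniteCompletion.etaFn (GrpCat.of (Multiplicative ℤ)) (Multiplicative.ofAdd (1 : ℤ))

/-- The subgroup `m ℤ`. -/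
def sub (m : ℕ) [NeZero m] : FiniteIndexNormalSubgroup (GrpCat.of (Multiplicative ℤ)) :=
  FiniteIndexNormalSubgroup.ofSubgroup (G := Multiplicative ℤ)
    (AddMonoidHom.toMultiplicative (Int.castAddHom (ZMod m))).ker

/-- The integer `n` represents the image of `g` in `ℤ / m`. -/
def IsRep (g : ZHat) (m : ℕ) [NeZero m] (n : ℤ) : Prop :=
  (QuotientGroup.mk (Multiplicative.ofAdd n) : Multiplicative ℤ ⧸ (sub m).toSubgroup) = g.1 (sub m)

theorem exists_isRep (g : ZHat) (m : ℕ) [NeZero m] : ∃ n, IsRep g m n := by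
  obtain ⟨n, hn⟩ := QuotientGroup.mk_surjective
    (show Multiplicative ℤ ⧸ (sub m).toSubgroup from g.1 (sub m))
  exact ⟨n.toAdd, hn⟩

theorem mk_eq_iff (m : ℕ) [NeZero m] (a b : ℤ) :
    (QuotientGroup.mk (Multiplicative.ofAdd a) : Multiplicative ℤ ⧸ (sub m).toSubgroup) =
      QuotientGroup.mk (Multiplicative.ofAdd b) ↔ (m : ℤ) ∣ b - a := by
  rw [QuotientGroup.eq, ← ZMod.intCast_zmod_eq_zero_iff_dvd]
  change ((-a + b : ℤ) : ZMod m) = 0 ↔ ((b - a : ℤ) : ZMod m) = 0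
  rw [neg_add_eq_sub]

theorem sub_le {m m' : ℕ} [NeZero m] [NeZero m'] (hm : m' ∣ m) : sub m ≤ sub m' := by
  intro x hx
  change ((Multiplicative.toAdd x : ℤ) : ZMod m') = 0
  have hx' : ((Multiplicative.toAdd x : ℤ) : ZMod m) = 0 := hx
  rw [ZMod.intCast_zmod_eq_zero_iff_dvd] at hx' ⊢
  exact (Int.natCast_dvd_natCast.2 hm).trans hx'

theorem IsRep.of_dvd {g : ZHat} {m m' : ℕ} [NeZero m] [NeZero m'] {n : ℤ} (h : IsRep g m n)
    (hm : m' ∣ m) : IsRep g m' n := by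
  have hg := g.2 (CategoryTheory.homOfLE (sub_le hm))
  unfold IsRep at h ⊢
  rw [← hg, ← h]
  rfl

theorem IsRep.mul {g g' : ZHat} {m : ℕ} [NeZero m] {n n' : ℤ} (h : IsRep g m n)
    (h' : IsRep g' m n') : IsRep (g * g') m (n + n') := by
  unfold IsRep at h h' ⊢
  change _ = g.1 (sub m) * g'.1 (sub m)
  rw [← h, ← h']
  rfl

theorem IsRep.dvd {g : ZHat} {m : ℕ} [NeZero m] {n n' : ℤ} (h : IsRep g m n)
    (h' : IsRep g m n') : (m : ℤ) ∣ n' - n :=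
  (mk_eq_iff m n n').1 (h.trans h'.symm)

theorem IsRep.one (m : ℕ) [NeZero m] : IsRep 1 m 0 := rfl

theorem IsRep.gen (m : ℕ) [NeZero m] : IsRep gen m 1 := rfl

end ZHat

/-- A compatible choice of primitive `m`-th roots of unity `ζ_m`, for all `m ≥ 1`. -/
structure CompatibleRoots (k : Type*) [Field k] where
  ζ : ℕ → k
  primitive : ∀ m, 1 ≤ m → IsPrimitiveRoot (ζ m) m
  compatible : ∀ m l, 1 ≤ m → 1 ≤ l → ζ (m * l) ^ l = ζ m

namespace CompatibleRoots

variable {k : Type*} [Field k] (Z : CompatibleRoots k)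

theorem ne_zero (m : ℕ) [NeZero m] : Z.ζ m ≠ 0 :=
  (Z.primitive m (NeZero.one_le)).ne_zero (NeZero.ne m)

instance (q : ℚ) : NeZero q.den := ⟨q.den_nz⟩

/-- The scalar `χ(g, a / m) = ζ_m ^ (a n)` by which `g` acts on `t ^ (a / m)`, where the integer `n`
represents `g` modulo `m`; here `a / m` is in lowest terms. -/
def chi (g : ZHat) (q : ℚ) : k :=
  Z.ζ q.den ^ (q.num * (ZHat.exists_isRep g q.den).choose)

theorem chi_eq (g : ZHat) (q : ℚ) (m : ℕ) [NeZero m] (a n : ℤ) (hq : q = a / m)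
    (hn : ZHat.IsRep g m n) : Z.chi g q = Z.ζ m ^ (a * n) := by
  have hdvd : q.den ∣ m := by
    have h := Rat.den_dvd a m
    rw [Rat.divInt_eq_div, Int.cast_natCast, ← hq] at h
    exact Int.natCast_dvd_natCast.1 h
  obtain ⟨l, hl⟩ := hdvd
  have hl1 : 1 ≤ l := Nat.one_le_iff_ne_zero.2 fun h => NeZero.ne m (by rw [hl, h, mul_zero])
  have ha : a = q.num * l := by
    have h1 : (a : ℚ) = q * m := by
      rw [hq, div_mul_cancel₀ _ (by exact_mod_cast NeZero.ne m)]
    have h2 : (a : ℚ) = q.num * l := by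
      rw [h1, hl]
      push_cast
      rw [← mul_assoc, Rat.mul_den_eq_num]
    exact_mod_cast h2
  have hc := (ZHat.exists_isRep g q.den).choose_spec
  obtain ⟨d, hd⟩ := (hn.of_dvd ⟨l, hl⟩).dvd hc
  have hζ : Z.ζ m ^ l = Z.ζ q.den := by
    rw [← Z.compatible q.den l q.den_pos hl1, ← hl]
  rw [chi, show (ZHat.exists_isRep g q.den).choose = n + q.den * d by omega, ha,
    show q.num * (l : ℤ) * n = l * (q.num * n) by ring, zpow_mul (Z.ζ m), zpow_natCast, hζ, mul_add,
    zpow_add₀ (Z.ne_zero _), show q.num * (q.den * d) = q.den * (q.num * d) by ring,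
    zpow_mul _ (q.den : ℤ), zpow_natCast, (Z.primitive q.den q.den_pos).pow_eq_one, one_zpow,
    mul_one]

theorem chi_zero (g : ZHat) : Z.chi g 0 = 1 := by
  simp [chi]

theorem chi_intCast (g : ZHat) (n : ℤ) : Z.chi g n = 1 := by
  obtain ⟨r, hr⟩ := ZHat.exists_isRep g 1
  rw [Z.chi_eq g n 1 n r (by simp) hr]
  have : Z.ζ 1 = 1 := by simpa using (Z.primitive 1 le_rfl).pow_eq_one
  rw [this, one_zpow]

theorem chi_add (g : ZHat) (p q : ℚ) : Z.chi g (p + q) = Z.chi g p * Z.chi g q := by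
  have hp : (p.den : ℚ) ≠ 0 := by exact_mod_cast p.den_nz
  have hq : (q.den : ℚ) ≠ 0 := by exact_mod_cast q.den_nz
  obtain ⟨n, hn⟩ := ZHat.exists_isRep g (p.den * q.den)
  rw [Z.chi_eq g p (p.den * q.den) (p.num * q.den) n
      (by push_cast; rw [mul_div_mul_right _ _ hq, Rat.num_div_den]) hn,
    Z.chi_eq g q (p.den * q.den) (q.num * p.den) n
      (by push_cast; rw [mul_comm (p.den : ℚ), mul_div_mul_right _ _ hp, Rat.num_div_den]) hn,
    Z.chi_eq g (p + q) (p.den * q.den) (p.num * q.den + q.num * p.den) n ?_ hn,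
    ← zpow_add₀ (Z.ne_zero _), add_mul]
  push_cast
  rw [add_div, mul_div_mul_right _ _ hq, mul_comm (p.den : ℚ), mul_div_mul_right _ _ hp,
    Rat.num_div_den, Rat.num_div_den]

theorem chi_mul (g h : ZHat) (q : ℚ) : Z.chi (g * h) q = Z.chi g q * Z.chi h q := by
  obtain ⟨n, hn⟩ := ZHat.exists_isRep g q.den
  obtain ⟨m, hm⟩ := ZHat.exists_isRep h q.den
  have hq : q = q.num / q.den := (Rat.num_div_den q).symm
  rw [Z.chi_eq g q q.den q.num n hq hn, Z.chi_eq h q q.den q.num m hq hm,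
    Z.chi_eq (g * h) q q.den q.num (n + m) hq (hn.mul hm), mul_add, zpow_add₀ (Z.ne_zero _)]

theorem chi_one (q : ℚ) : Z.chi 1 q = 1 := by
  rw [Z.chi_eq 1 q q.den q.num 0 (Rat.num_div_den q).symm (ZHat.IsRep.one _), mul_zero, zpow_zero]

/-- The generator of `Ẑ` acts on `t ^ (1 / m)` by `ζ_m`. -/
theorem chi_gen (m : ℕ) [NeZero m] : Z.chi ZHat.gen (1 / m) = Z.ζ m := by
  rw [Z.chi_eq ZHat.gen (1 / m) m 1 1 (by simp) (ZHat.IsRep.gen m)]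
  simp

variable [CharZero k]

/-- The ring endomorphism `t ^ q ↦ χ(g, q) t ^ q` of `Ŝ`. -/
def galRingHom (g : ZHat) : SHat k →+* SHat k :=
  (AddMonoidAlgebra.lift k (SHat k) ℚ
    { toFun := fun q => AddMonoidAlgebra.single q.toAdd (Z.chi g q.toAdd)
      map_one' := by
        change AddMonoidAlgebra.single (0 : ℚ) (Z.chi g 0) = 1
        rw [chi_zero]
        rfl
      map_mul' := fun p q => by
        rw [AddMonoidAlgebra.single_mul_single, ← chi_add]
        rfl }).toRingHom

theorem galRingHom_single (g : ZHat) (q : ℚ) (a : k) :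
    Z.galRingHom g (AddMonoidAlgebra.single q a) = AddMonoidAlgebra.single q (Z.chi g q * a) := by
  refine (AddMonoidAlgebra.lift_single _ _ _).trans ?_
  change a • AddMonoidAlgebra.single q (Z.chi g q) = _
  rw [AddMonoidAlgebra.smul_single, smul_eq_mul, mul_comm]

/-- The action of `g ∈ Ẑ` on `Ŝ`, as a homomorphism of commutative `R`-vertex algebras:
`t ^ q ↦ χ(g, q) t ^ q`. -/
def gal (g : ZHat) : HSHom (LaurentRing k) (SHat k) (SHat k) where
  toAlgHom :=
    { Z.galRingHom g with
      commutes' := fun r => by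
        change Z.galRingHom g (algebraMap (LaurentRing k) (SHat k) r) = algebraMap _ _ r
        induction r using AddMonoidAlgebra.induction_linear with
        | zero => simp
        | add x x' hx hx' => simp only [map_add, hx, hx']
        | single n a => rw [algebraMap_single, galRingHom_single, chi_intCast, one_mul] }
  map_D n s := by
    refine map_ofDerivation ((ddt k (algebraMap ℚ k)).restrictScalars ℚ)
      ((ddt k (algebraMap ℚ k)).restrictScalars ℚ) (Z.galRingHom g) (fun x => ?_) n s
    change Z.galRingHom g (ddtLin k _ x) = ddtLin k _ (Z.galRingHom g x)
    induction x using AddMonoidAlgebra.induction_linear with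
    | zero => simp
    | add x x' hx hx' => simp only [map_add, hx, hx']
    | single q a =>
      rw [ddtLin_single, galRingHom_single, galRingHom_single, ddtLin_single,
        show q - 1 = q + ((-1 : ℤ) : ℚ) by push_cast; ring, chi_add, chi_intCast]
      congr 1
      ring

theorem gal_single (g : ZHat) (q : ℚ) (a : k) :
    (Z.gal g).toAlgHom (AddMonoidAlgebra.single q a) =
      AddMonoidAlgebra.single q (Z.chi g q * a) := Z.galRingHom_single g q a

theorem hsHom_ext {f f' : HSHom (LaurentRing k) (SHat k) (SHat k)}
    (h : ∀ q a, f.toAlgHom (AddMonoidAlgebra.single q a) =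
      f'.toAlgHom (AddMonoidAlgebra.single q a)) : f = f' := by
  have : f.toAlgHom = f'.toAlgHom := by
    ext1 x
    induction x using AddMonoidAlgebra.induction_linear with
    | zero => simp
    | add x x' hx hx' => simp only [map_add, hx, hx']
    | single q a => exact h q a
  cases f
  cases f'
  simp only at this
  subst this
  rfl

theorem gal_mul (g h : ZHat) : Z.gal (g * h) = (Z.gal g).comp (Z.gal h) := by
  refine hsHom_ext fun q a => ?_
  change _ = (Z.gal g).toAlgHom ((Z.gal h).toAlgHom _)
  rw [gal_single, gal_single, gal_single, chi_mul, mul_assoc]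

theorem gal_one : Z.gal 1 = HSHom.id _ _ := by
  refine hsHom_ext fun q a => ?_
  rw [gal_single, chi_one, one_mul]
  rfl

/-- `1 ∈ Ẑ` acts by `t ^ (1 / m) ↦ ζ_m t ^ (1 / m)`. -/
theorem gal_gen (m : ℕ) [NeZero m] : (Z.gal ZHat.gen).toAlgHom (AddMonoidAlgebra.single (1 / m) 1) =
    Z.ζ m • AddMonoidAlgebra.single (1 / (m : ℚ)) 1 := by
  rw [gal_single, chi_gen, AddMonoidAlgebra.smul_single, smul_eq_mul]

variable {V : Type*} [AddCommGroup V] [VertexRing V] [VertexAlgebra (LaurentRing k) V]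
  (𝓕 : VertexFiltration (LaurentRing k) V)

/-- The action of `Ẑ` on `Aut(V)(Ŝ)`, induced by functoriality from the action on `Ŝ`. -/
def autAction : ZHat →* MulAut (VAut 𝓕 (SHat k)) where
  toFun g :=
    { VAut.map (𝓕 := 𝓕) (Z.gal g) with
      invFun := VAut.map (Z.gal g⁻¹)
      left_inv := fun h => by
        change VAut.map (Z.gal g⁻¹) (VAut.map (Z.gal g) h) = h
        rw [← VAut.map_comp, ← gal_mul, inv_mul_cancel, gal_one, VAut.map_id]
      right_inv := fun h => by
        change VAut.map (Z.gal g) (VAut.map (Z.gal g⁻¹) h) = h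
        rw [← VAut.map_comp, ← gal_mul, mul_inv_cancel, gal_one, VAut.map_id] }
  map_one' := by
    ext1 h
    change VAut.map (Z.gal 1) h = h
    rw [gal_one, VAut.map_id]
  map_mul' g g' := by
    ext1 h
    change VAut.map (Z.gal (g * g')) h = VAut.map (Z.gal g) (VAut.map (Z.gal g') h)
    rw [gal_mul, VAut.map_comp]

/-- The action is `ᵍh = (g ⊗ id) h (g⁻¹ ⊗ id)`. -/
theorem autAction_equiv (g : ZHat) (h : VAut 𝓕 (SHat k)) (x : SHat k ⊗[LaurentRing k] V) :
    (Z.autAction 𝓕 g h).equiv x =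
      VAut.push V (Z.gal g) (h.equiv (VAut.push V (Z.gal g⁻¹) x)) := by
  change (VAut.map (Z.gal g) h).equiv x = _
  rw [← VAut.map_equiv_push, ← VAut.push_comp, ← gal_mul, mul_inv_cancel, gal_one, VAut.push_id]

/-- The map `Ŝ ⊗ Ŝ → Ŝ`, `a ⊗ b ↦ a g(b)`, for `g ∈ Ẑ`. -/
def ev (g : ZHat) : HSHom (LaurentRing k) (SHat k ⊗[LaurentRing k] SHat k) (SHat k) :=
  HSHom.productMap (HSHom.id (LaurentRing k) (SHat k)) (Z.gal g)

end CompatibleRoots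

end

/-! The extension `Ŝ/R` is pro-Galois with group `Ẑ`: through the evaluations `ev g`, the ring `Ŝ ⊗
Ŝ` behaves like the ring of locally constant functions `Ẑ → Ŝ`. Under this dictionary an
automorphism over `Ŝ ⊗ Ŝ` is a locally constant function `Ẑ → Aut(V)(Ŝ)`. The descent cocycle
condition becomes the Galois cocycle condition, and the two coboundary relations coincide with the
same `λ`.

The dictionary rests on explicit idempotents. For each `m`, the roots of unity give idempotents
`idem m j` with `j < m`, which play the role of the indicator functions of the classes mod `m`. On
the component cut out by `idem m j`, an element `1 ⊗ s` of level `m` equals `g(s) ⊗ 1` for every `g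
≡ j`. Splitting `1 = ∑ idem m j` then has two consequences. A vector of `(A ⊗ Ŝ) ⊗ V` is determined
by its evaluations (`eq_of_push_evAlong_eq`); no flatness of `V` is needed. And a function on `ℤ/m`
with values in `Aut(V)(Ŝ)` is realised over `Ŝ ⊗ Ŝ` by gluing (`exists_map_ev_eq`). Gluing is
compatible with vertex algebra products, although these involve derivatives of scalars, because
every `D_n` with `n > 0` kills idempotents.

Finite generation enters through continuity. An automorphism is determined by its values on finitely
many generators, each value involves finitely many scalars, and each scalar has finite level; hence
`g ↦ Aut(V)(f_g)(h)` factors through some `ℤ/m` (`finiteLevel_map`). This gives a) and the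
continuity of the cocycle attached to `φ`. Conversely, a continuous cocycle with discrete values has
finite level (`finiteLevel_of_cocycle`), so it can be glued. -/

noncomputable section

set_option linter.unusedSectionVars false

open NProducts

/-! ### The topology of `Ẑ` in terms of residues -/

namespace ZHat

/-- The quotient by `H` is a finite group of order `H.index`, so multiples of the index lie in `H`.
This makes the subgroups `m ℤ` cofinal. -/
theorem sub_le_of_index_dvd (H : FiniteIndexNormalSubgroup (GrpCat.of (Multiplicative ℤ)))
    (m : ℕ) [NeZero m] (hm : H.toSubgroup.index ∣ m) : sub m ≤ H := by
  intro x hx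
  have hx' : ((Multiplicative.toAdd x : ℤ) : ZMod m) = 0 := hx
  rw [ZMod.intCast_zmod_eq_zero_iff_dvd] at hx'
  obtain ⟨d, hd⟩ := (Int.natCast_dvd_natCast.2 hm).trans hx'
  have : x = (Multiplicative.ofAdd d : Multiplicative ℤ) ^ H.toSubgroup.index := by
    rw [← ofAdd_nsmul, nsmul_eq_mul, ← hd]
    rfl
  rw [this]
  exact Subgroup.pow_index_mem H.toSubgroup _

theorem IsRep.apply_eq_one {g : ZHat} {m : ℕ} [NeZero m] (h : IsRep g m 0)
    {H : FiniteIndexNormalSubgroup (GrpCat.of (Multiplicative ℤ))} (hH : sub m ≤ H) :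
    g.1 H = (1 : ZHat).1 H := by
  have hg := g.2 (CategoryTheory.homOfLE hH)
  unfold IsRep at h
  rw [← hg, ← h]
  rfl

theorem exists_isRep_zero_subset {U : Set ZHat} (hU : IsOpen U) (h1 : 1 ∈ U) :
    ∃ (m : ℕ) (_ : NeZero m), ∀ g, IsRep g m 0 → g ∈ U := by
  obtain ⟨s, hs, rfl⟩ := hU
  -- A basic neighbourhood in the product constrains only the finitely many coordinates in `J`; the
  -- product of their indices is a modulus that controls them all.
  obtain ⟨J, f, hJ, hJs⟩ := isOpen_pi_iff.mp hs _ h1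
  have hm : NeZero (∏ H ∈ J, H.toSubgroup.index) :=
    ⟨Finset.prod_ne_zero_iff.2 fun H _ => Subgroup.FiniteIndex.index_ne_zero⟩
  refine ⟨∏ H ∈ J, H.toSubgroup.index, hm, fun g hg => hJs fun H hH => ?_⟩
  rw [hg.apply_eq_one (sub_le_of_index_dvd H _ (Finset.dvd_prod_of_mem _ hH))]
  exact (hJ H hH).2

theorem isOpen_isRep (m : ℕ) [NeZero m] (n : ℤ) : IsOpen {g | IsRep g m n} := by
  let X := (ProfiniteGrp.ProfiniteCompletion.diagram (GrpCat.of (Multiplicative ℤ))).obj (sub m)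
  have hX : DiscreteTopology X := ⟨rfl⟩
  have hc : Continuous fun g : ZHat => (g.1 (sub m) : X) :=
    (continuous_apply (sub m)).comp continuous_subtype_val
  have ho : IsOpen ({(QuotientGroup.mk (Multiplicative.ofAdd n) :
      Multiplicative ℤ ⧸ (sub m).toSubgroup)} : Set X) := isOpen_discrete _
  convert ho.preimage hc using 1
  ext g
  exact eq_comm

theorem IsRep.inv {g : ZHat} {m : ℕ} [NeZero m] {n : ℤ} (h : IsRep g m n) :
    IsRep g⁻¹ m (-n) := by
  unfold IsRep at h ⊢
  change _ = (g.1 (sub m))⁻¹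
  rw [← h]
  rfl

theorem isRep_of_dvd {g : ZHat} {m : ℕ} [NeZero m] {n n' : ℤ} (h : IsRep g m n)
    (hd : (m : ℤ) ∣ n' - n) : IsRep g m n' :=
  ((mk_eq_iff m n n').2 hd).symm.trans h

theorem isRep_gen_pow (m : ℕ) [NeZero m] (n : ℕ) : IsRep (ZHat.gen ^ n) m n := by
  induction n with
  | zero => exact IsRep.one m
  | succ n ih =>
    rw [pow_succ, Nat.cast_succ]
    exact ih.mul (IsRep.gen m)

theorem exists_isRep_gen_pow (g : ZHat) (m : ℕ) [NeZero m] :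
    ∃ j < m, IsRep g m (j : ℤ) := by
  obtain ⟨n, hn⟩ := exists_isRep g m
  have hm : (0 : ℤ) < m := by exact_mod_cast Nat.pos_of_ne_zero (NeZero.ne m)
  have h0 := Int.emod_nonneg n hm.ne'
  have h1 := Int.emod_lt_of_pos n hm
  refine ⟨(n % m).toNat, by omega, isRep_of_dvd hn ?_⟩
  rw [Int.toNat_of_nonneg h0]
  exact ⟨-(n / m), by have := Int.mul_ediv_add_emod n m; linarith⟩

end ZHat

/-! ### Hasse–Schmidt derivations kill idempotents -/

namespace HasseSchmidt

variable {S : Type*} [CommRing S] [HasseSchmidt S]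

/-- Both sides are idempotents of the power series ring with the same constant term. The difference
`d` of two commuting idempotents satisfies `d ^ 3 = d`, and `1 - d ^ 2` is a unit because `d` has
zero constant term; hence `d = 0`. -/
theorem series_eq_C_of_isIdempotentElem {e : S} (he : IsIdempotentElem e) :
    series e = PowerSeries.C e := by
  have h1 : series e * series e = series e := by rw [← series_mul, he.eq]
  have h2 : PowerSeries.C e * PowerSeries.C e = PowerSeries.C e := by rw [← map_mul, he.eq]
  have h3 : (series e - PowerSeries.C e) * (1 - (series e - PowerSeries.C e) ^ 2) = 0 := by
    generalize series e = a at *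
    generalize PowerSeries.C e = b at *
    linear_combination (-a + 3 * b - 1) * h1 + (1 - 3 * a + b) * h2
  have hu : IsUnit (1 - (series e - PowerSeries.C e) ^ 2) := by
    rw [PowerSeries.isUnit_iff_constantCoeff]
    have : PowerSeries.constantCoeff (series e) = e := by
      rw [← PowerSeries.coeff_zero_eq_constantCoeff_apply, coeff_series, D_zero]
    simp [this]
  exact sub_eq_zero.1 (hu.mul_left_eq_zero.1 h3)

theorem D_eq_zero_of_isIdempotentElem {e : S} (he : IsIdempotentElem e) {n : ℕ} (hn : n ≠ 0) :
    D n e = 0 := by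
  rw [← coeff_series, series_eq_C_of_isIdempotentElem he, PowerSeries.coeff_C, if_neg hn]

end HasseSchmidt

/-! ### Automorphisms: rigidity on generators and gluing along idempotents -/

namespace VAut

variable {R V : Type*} [CommRing R] [HasseSchmidt R] [AddCommGroup V] [VertexRing V]
  [VertexAlgebra R V] {𝓕 : VertexFiltration R V}
variable {T U : Type*} [CommRing T] [HasseSchmidt T] [Algebra R T] [HSAlgebra R T]
  [CommRing U] [HasseSchmidt U] [Algebra R U] [HSAlgebra R U]

theorem equiv_nprod (h : VAut 𝓕 T) (n : ℤ) (x y : T ⊗[R] V) :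
    h.equiv (nprod n x y) = nprod n (h.equiv x) (h.equiv y) := h.2.1 n x y

theorem equiv_vac (h : VAut 𝓕 T) : h.equiv vac = vac := h.2.2.1

theorem equiv_mem_iff (h : VAut 𝓕 T) (i : ℤ) (x : T ⊗[R] V) :
    h.equiv x ∈ (𝓕.F i).baseChange T ↔ x ∈ (𝓕.F i).baseChange T := h.2.2.2 i x

theorem one_tmul_nprod (n : ℤ) (u v : V) :
    (1 : T) ⊗ₜ[R] nprod n u v = nprod n ((1 : T) ⊗ₜ[R] u) ((1 : T) ⊗ₜ[R] v) := by
  rw [BaseChange.nprod_tmul, finsum_eq_single _ 0]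
  · simp [HasseSchmidt.D_zero]
  · intro j hj
    simp [HasseSchmidt.D_one, hj]

theorem ext_one_tmul {h h' : VAut 𝓕 T}
    (H : ∀ v : V, h.equiv (1 ⊗ₜ[R] v) = h'.equiv (1 ⊗ₜ[R] v)) : h = h' := by
  refine ext fun x => ?_
  induction x with
  | zero => simp
  | add x y hx hy => simp only [map_add, hx, hy]
  | tmul t v =>
    have : t ⊗ₜ[R] v = t • (1 : T) ⊗ₜ[R] v := by simp [TensorProduct.smul_tmul']
    rw [this, map_smul, map_smul, H]

/-- An automorphism is determined by its values on generators. -/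
theorem ext_of_generators {s : Set V}
    (hs : ∀ W : Submodule R V, vac ∈ W →
      (∀ (n : ℤ) (u v : V), u ∈ W → v ∈ W → nprod n u v ∈ W) → s ⊆ W → W = ⊤)
    {h h' : VAut 𝓕 T} (H : ∀ v ∈ s, h.equiv (1 ⊗ₜ[R] v) = h'.equiv (1 ⊗ₜ[R] v)) : h = h' := by
  let ℓ : VAut 𝓕 T → V →ₗ[R] T ⊗[R] V := fun h =>
    (h.equiv : T ⊗[R] V →ₗ[T] T ⊗[R] V).restrictScalars R ∘ₗ TensorProduct.mk R T V 1
  -- The locus in `V` where the two automorphisms agree is an `R`-vertex subalgebra containing the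
  -- generators.
  have hW := hs (LinearMap.eqLocus (ℓ h) (ℓ h')) ?_ ?_ H
  · exact ext_one_tmul fun v => (hW ▸ Submodule.mem_top : v ∈ LinearMap.eqLocus (ℓ h) (ℓ h'))
  · exact h.equiv_vac.trans h'.equiv_vac.symm
  · intro n u v hu hv
    change h.equiv (1 ⊗ₜ[R] u) = h'.equiv (1 ⊗ₜ[R] u) at hu
    change h.equiv (1 ⊗ₜ[R] v) = h'.equiv (1 ⊗ₜ[R] v) at hv
    change h.equiv (1 ⊗ₜ[R] _) = h'.equiv (1 ⊗ₜ[R] _)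
    rw [one_tmul_nprod, equiv_nprod, equiv_nprod, hu, hv]

theorem map_equiv_one_tmul (f : HSHom R T U) (h : VAut 𝓕 T) (v : V) :
    (map f h).equiv (1 ⊗ₜ[R] v) = push V f (h.equiv (1 ⊗ₜ[R] v)) := by
  rw [← map_equiv_push, push_tmul, map_one]

section Glue

variable {ι : Type*} [Fintype ι]

/-- Products are linear on the right, but on the left a scalar contributes all its derivatives. For
an idempotent only the term `D 0` survives, so products respect the decomposition of `T` by
idempotents. -/
theorem nprod_smul_smul (n : ℤ) {e : T} (he : IsIdempotentElem e) (t : T) (x y : T ⊗[R] V) :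
    nprod n (e • x) (t • y) = (e * t) • nprod n x y := by
  rw [BaseChange.nprod_smul, BaseChange.smul_nprod, finsum_eq_single _ 0]
  · simp [HasseSchmidt.D_zero, smul_smul, mul_comm]
  · intro j hj
    rw [HasseSchmidt.D_eq_zero_of_isIdempotentElem he hj, zero_smul]

/-- The linear map `∑ i, e i • φ i`. -/
def glueLin (e : ι → T) (φ : ι → VAut 𝓕 T) : T ⊗[R] V →ₗ[T] T ⊗[R] V :=
  ∑ i, e i • ((φ i).equiv : T ⊗[R] V →ₗ[T] T ⊗[R] V)

theorem glueLin_apply (e : ι → T) (φ : ι → VAut 𝓕 T) (x : T ⊗[R] V) :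
    glueLin e φ x = ∑ i, e i • (φ i).equiv x := by
  simp [glueLin]

/-- Orthogonality removes the cross terms. Taking `ψ = φ⁻¹` provides the inverse of a glued map. -/
theorem glueLin_mul {e : ι → T} (he : CompleteOrthogonalIdempotents e) (φ ψ : ι → VAut 𝓕 T)
    (x : T ⊗[R] V) : glueLin e (φ * ψ) x = glueLin e φ (glueLin e ψ x) := by
  classical
  simp only [glueLin_apply, map_sum, map_smul, Finset.smul_sum, smul_smul]
  rw [Finset.sum_comm]
  refine Finset.sum_congr rfl fun i _ => ?_
  simp only [he.mul_eq, ite_smul, zero_smul, eq_comm (b := i)]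
  simp [mul_equiv]

theorem glueLin_one {e : ι → T} (he : CompleteOrthogonalIdempotents e) (x : T ⊗[R] V) :
    glueLin e (1 : ι → VAut 𝓕 T) x = x := by
  simp only [glueLin_apply, Pi.one_apply, one_equiv, ← Finset.sum_smul, he.complete, one_smul]

theorem glueLin_nprod {e : ι → T} (he : CompleteOrthogonalIdempotents e) (φ : ι → VAut 𝓕 T)
    (n : ℤ) (x y : T ⊗[R] V) :
    glueLin e φ (nprod n x y) = nprod n (glueLin e φ x) (glueLin e φ y) := by
  classical
  simp only [glueLin_apply, map_sum, AddMonoidHom.finsetSum_apply, nprod_smul_smul n (he.idem _)]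
  refine Finset.sum_congr rfl fun i _ => ?_
  simp only [he.mul_eq, ite_smul, zero_smul, eq_comm (b := i)]
  simp [equiv_nprod]

theorem glueLin_mem (e : ι → T) (φ : ι → VAut 𝓕 T) (i : ℤ) (x : T ⊗[R] V)
    (hx : x ∈ (𝓕.F i).baseChange T) : glueLin e φ x ∈ (𝓕.F i).baseChange T := by
  rw [glueLin_apply]
  exact sum_mem fun j _ => Submodule.smul_mem _ _ (((φ j).equiv_mem_iff i x).2 hx)

/-- The automorphism that equals `φ i` on the component cut out by the idempotent `e i`. -/
def glue {e : ι → T} (he : CompleteOrthogonalIdempotents e) (φ : ι → VAut 𝓕 T) : VAut 𝓕 T :=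
  ⟨{ glueLin e φ with
      invFun := glueLin e φ⁻¹
      left_inv := fun x => by
        change glueLin e φ⁻¹ (glueLin e φ x) = x
        rw [← glueLin_mul he, inv_mul_cancel, glueLin_one he]
      right_inv := fun x => by
        change glueLin e φ (glueLin e φ⁻¹ x) = x
        rw [← glueLin_mul he, mul_inv_cancel, glueLin_one he] },
    glueLin_nprod he φ, by
      change glueLin e φ vac = vac
      simp only [glueLin_apply, equiv_vac, ← Finset.sum_smul, he.complete, one_smul],
    fun i x => by
      refine ⟨fun hx => ?_, glueLin_mem e φ i x⟩
      have := glueLin_mem e φ⁻¹ i _ hx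
      change glueLin e φ⁻¹ (glueLin e φ x) ∈ _ at this
      rwa [← glueLin_mul he, inv_mul_cancel, glueLin_one he] at this⟩

theorem glue_equiv {e : ι → T} (he : CompleteOrthogonalIdempotents e) (φ : ι → VAut 𝓕 T)
    (x : T ⊗[R] V) : (glue he φ).equiv x = ∑ i, e i • (φ i).equiv x := glueLin_apply e φ x

/-- A base change supported on the `i`-th component sees only `φ i`; this is how a glued
automorphism is evaluated. -/
theorem map_glue [DecidableEq ι] {e : ι → T} (he : CompleteOrthogonalIdempotents e)
    (φ : ι → VAut 𝓕 T) (f : HSHom R T U) (i : ι)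
    (hf : ∀ j, f.toAlgHom (e j) = if j = i then 1 else 0) :
    map f (glue he φ) = map f (φ i) := by
  refine ext_one_tmul fun v => ?_
  rw [map_equiv_one_tmul, map_equiv_one_tmul, glue_equiv, map_sum]
  simp [push_smul, hf]

end Glue

end VAut

/-! ### The idempotents of `Ŝ ⊗ Ŝ` -/

namespace CompatibleRoots

variable {k : Type*} [Field k]

/-- Orthogonality of the characters of `ℤ/m`: the ratio is an `m`-th root of unity, different from
`1` when `i ≠ j`, and then the geometric sum vanishes. -/
theorem geom_sum_eq_ite {K : Type*} [Field K] [CharZero K] {ζ : K} {m : ℕ} [NeZero m]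
    (hζ : IsPrimitiveRoot ζ m) {i j : ℕ} (hi : i < m) (hj : j < m) :
    (m : K)⁻¹ * ∑ a ∈ Finset.range m, (ζ⁻¹ ^ j * ζ ^ i) ^ a = if j = i then 1 else 0 := by
  have hm : (m : K) ≠ 0 := by exact_mod_cast NeZero.ne m
  have h0 : ζ ≠ 0 := hζ.ne_zero (NeZero.ne m)
  split_ifs with h
  · subst h
    rw [← mul_pow, inv_mul_cancel₀ h0]
    simp [hm]
  · have hr : ζ⁻¹ ^ j * ζ ^ i ≠ 1 := fun hr => h <| by
      refine hζ.pow_inj hj hi ?_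
      rw [inv_pow, inv_mul_eq_one₀ (pow_ne_zero _ h0)] at hr
      exact hr
    have hp : (ζ⁻¹ ^ j * ζ ^ i) ^ m = 1 := by
      rw [mul_pow, ← pow_mul, ← pow_mul, mul_comm j, mul_comm i, pow_mul, pow_mul, inv_pow,
        hζ.pow_eq_one]
      simp
    have hs := geom_sum_mul (ζ⁻¹ ^ j * ζ ^ i) m
    rw [hp, sub_self, mul_eq_zero] at hs
    rw [hs.resolve_right (sub_ne_zero.2 hr), mul_zero]

variable [CharZero k]

/-- The scalars `k` in an `R`-algebra. -/
def scalar (k : Type*) [Field k] [CharZero k] (A : Type*) [CommRing A] [Algebra (LaurentRing k) A] :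
    k →+* A :=
  (algebraMap (LaurentRing k) A).comp AddMonoidAlgebra.singleZeroRingHom

theorem map_scalar {A B : Type*} [CommRing A] [Algebra (LaurentRing k) A] [CommRing B]
    [Algebra (LaurentRing k) B] (f : A →ₐ[LaurentRing k] B) (c : k) :
    f (scalar k A c) = scalar k B c := f.commutes _

theorem scalar_sHat (c : k) : scalar k (SHat k) c = AddMonoidAlgebra.single 0 c := by
  change algebraMap (LaurentRing k) (SHat k) (AddMonoidAlgebra.single 0 c) = _
  rw [algebraMap_single, Int.cast_zero]

variable (k) in
/-- The element `t ^ (-q) ⊗ t ^ q`. -/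
def monomialUnit (q : ℚ) : SHat k ⊗[LaurentRing k] SHat k :=
  AddMonoidAlgebra.single (-q) 1 ⊗ₜ AddMonoidAlgebra.single q 1

theorem monomialUnit_add (p q : ℚ) :
    monomialUnit k (p + q) = monomialUnit k p * monomialUnit k q := by
  simp only [monomialUnit, Algebra.TensorProduct.tmul_mul_tmul,
    AddMonoidAlgebra.single_mul_single, mul_one]
  rw [neg_add]

/-- An integral power of `t` lies in `R`, hence moves across the tensor sign. So `t ^ (-1/m) ⊗ t ^
(1/m)` is an `m`-th root of `1`. -/
theorem monomialUnit_intCast (n : ℤ) : monomialUnit k n = 1 := by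
  have h : (AddMonoidAlgebra.single (n : ℚ) 1 : SHat k) =
      (AddMonoidAlgebra.single n 1 : LaurentRing k) • (1 : SHat k) := by
    rw [Algebra.smul_def, algebraMap_single, mul_one]
  rw [monomialUnit, h, TensorProduct.tmul_smul, TensorProduct.smul_tmul', Algebra.smul_def,
    algebraMap_single, AddMonoidAlgebra.single_mul_single, add_neg_cancel, mul_one]
  rfl

theorem monomialUnit_natCast_mul (a : ℕ) (q : ℚ) :
    monomialUnit k (a * q) = monomialUnit k q ^ a := by
  induction a with
  | zero => simpa using monomialUnit_intCast (k := k) 0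
  | succ a ih => rw [Nat.cast_succ, add_mul, one_mul, monomialUnit_add, ih, pow_succ]

theorem one_tmul_single (q : ℚ) (c : k) :
    (1 : SHat k) ⊗ₜ[LaurentRing k] (AddMonoidAlgebra.single q c : SHat k) =
      (AddMonoidAlgebra.single q c : SHat k) ⊗ₜ 1 * monomialUnit k q := by
  rw [monomialUnit, Algebra.TensorProduct.tmul_mul_tmul, AddMonoidAlgebra.single_mul_single,
    add_neg_cancel, mul_one, one_mul]
  have h : (AddMonoidAlgebra.single q c : SHat k) = (AddMonoidAlgebra.single 0 c : LaurentRing k) •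
      AddMonoidAlgebra.single q 1 := by
    rw [Algebra.smul_def, algebraMap_single, AddMonoidAlgebra.single_mul_single]
    simp
  have h' : (AddMonoidAlgebra.single 0 c : SHat k) =
      (AddMonoidAlgebra.single 0 c : LaurentRing k) • (1 : SHat k) := by
    rw [Algebra.smul_def, algebraMap_single]
    simp
  rw [h, h', TensorProduct.tmul_smul, TensorProduct.smul_tmul']

/-- Euclidean division of `q m` by `m`. The remainder is taken in `ℕ` so that `monomialUnit k q`
becomes a natural power of `monomialUnit k (1 / m)`. -/
theorem exists_eq_add_div {q : ℚ} {m : ℕ} [NeZero m] (h : q.den ∣ m) :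
    ∃ (n : ℤ) (b : ℕ), q = n + b * (1 / (m : ℚ)) := by
  obtain ⟨l, hl⟩ := h
  have hm : (0 : ℤ) < m := by exact_mod_cast Nat.pos_of_ne_zero (NeZero.ne m)
  have hm' : (m : ℚ) ≠ 0 := by exact_mod_cast NeZero.ne m
  have h1 : q * m = q.num * l := by
    rw [hl]
    push_cast
    rw [← mul_assoc, Rat.mul_den_eq_num]
  refine ⟨q.num * l / m, (q.num * l % m).toNat, ?_⟩
  have h2 : (((q.num * l % m).toNat : ℤ) : ℚ) = ((q.num * l % m : ℤ) : ℚ) := by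
    rw [Int.toNat_of_nonneg (Int.emod_nonneg _ hm.ne')]
  rw [Int.cast_natCast] at h2
  have h3 : ((m * (q.num * l / m) + q.num * l % m : ℤ) : ℚ) = q.num * l := by
    rw [Int.mul_ediv_add_emod]
    push_cast
    rfl
  push_cast at h3
  rw [h2]
  field_simp
  linarith

variable (Z : CompatibleRoots k)

/-- The idempotent `(1 / m) ∑ ζ_m ^ (- j a) t ^ (- a / m) ⊗ t ^ (a / m)` of `Ŝ ⊗ Ŝ`. -/
def idem (m j : ℕ) : SHat k ⊗[LaurentRing k] SHat k :=
  scalar k _ (m : k)⁻¹ *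
    ∑ a ∈ Finset.range m, (scalar k _ ((Z.ζ m)⁻¹ ^ j) * monomialUnit k (1 / m)) ^ a

/-- The idempotent is the average of the powers of `y = ζ_m ^ (-j) u`, where `u = t ^ (-1/m) ⊗ t ^
(1/m)`. Since `y ^ m = 1`, this average absorbs `y`; in other words, `u` acts as the scalar `ζ_m ^
j` on the component `j`. -/
theorem idem_mul_monomialUnit (m : ℕ) [NeZero m] (j b : ℕ) :
    Z.idem m j * monomialUnit k (b * (1 / m)) = Z.idem m j * scalar k _ (Z.ζ m ^ (b * j)) := by
  set y := scalar k _ ((Z.ζ m)⁻¹ ^ j) * monomialUnit k (1 / m) with hy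
  have hU : monomialUnit k (1 / m) = scalar k _ (Z.ζ m ^ j) * y := by
    rw [hy, ← mul_assoc, ← map_mul, inv_pow, mul_inv_cancel₀ (pow_ne_zero _ (Z.ne_zero m)),
      map_one, one_mul]
  have hym : y ^ m = 1 := by
    rw [hy, mul_pow, ← map_pow, ← pow_mul, mul_comm j, pow_mul, inv_pow,
      (Z.primitive m NeZero.one_le).pow_eq_one, ← monomialUnit_natCast_mul,
      mul_one_div_cancel (by exact_mod_cast NeZero.ne m)]
    simpa using monomialUnit_intCast (k := k) 1
  have h1 : Z.idem m j * y = Z.idem m j := by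
    have := geom_sum_mul y m
    rw [hym, sub_self, mul_sub, mul_one, sub_eq_zero] at this
    rw [idem, ← hy, mul_assoc, this]
  have h2 : ∀ b : ℕ, Z.idem m j * y ^ b = Z.idem m j := by
    intro b
    induction b with
    | zero => rw [pow_zero, mul_one]
    | succ b ih => rw [pow_succ, ← mul_assoc, ih, h1]
  rw [monomialUnit_natCast_mul, hU, mul_pow, mul_left_comm, h2, ← map_pow, ← pow_mul,
    mul_comm j, mul_comm]

theorem completeOrthogonalIdempotents_idem (m : ℕ) [NeZero m] :
    CompleteOrthogonalIdempotents fun j : Fin m => Z.idem m j := by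
  have hmul : ∀ i j : Fin m, Z.idem m i * Z.idem m j = if j = i then Z.idem m i else 0 := by
    intro i j
    have hsum := geom_sum_eq_ite (Z.primitive m NeZero.one_le) i.2 j.2
    -- Multiplication by `idem m i` turns `monomialUnit k (1 / m)` into `ζ_m ^ i` inside `idem m j`,
    -- leaving a character sum.
    have : Z.idem m i * Z.idem m j = Z.idem m i * scalar k _ ((m : k)⁻¹ *
        ∑ a ∈ Finset.range m, ((Z.ζ m)⁻¹ ^ (j : ℕ) * Z.ζ m ^ (i : ℕ)) ^ a) := by
      rw [map_mul, map_sum]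
      conv_lhs => rw [idem.eq_1 Z m j]
      rw [mul_left_comm, mul_left_comm (Z.idem m i)]
      congr 1
      rw [Finset.mul_sum, Finset.mul_sum]
      refine Finset.sum_congr rfl fun a _ => ?_
      rw [mul_pow, mul_left_comm, ← monomialUnit_natCast_mul, idem_mul_monomialUnit, mul_left_comm,
        ← map_pow, ← map_mul, mul_pow, ← pow_mul (Z.ζ m), mul_comm a]
    rw [this, hsum]
    simp only [Fin.ext_iff]
    split_ifs <;> simp
  refine ⟨⟨fun i => (hmul i i).trans (if_pos rfl), fun i j h => ?_⟩, ?_⟩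
  · exact (hmul i j).trans (if_neg (Ne.symm h))
  · rw [Fin.sum_univ_eq_sum_range (Z.idem m)]
    simp only [idem]
    -- Completeness: after summing over the component index first, only the exponent `a = 0`
    -- survives.
    rw [← Finset.mul_sum, Finset.sum_comm, Finset.mul_sum, Finset.sum_eq_single_of_mem 0]
    · have hm : (m : k) ≠ 0 := by exact_mod_cast NeZero.ne m
      simp only [pow_zero, Finset.sum_const, Finset.card_range, nsmul_eq_mul, mul_one]
      rw [← map_natCast (scalar k (SHat k ⊗[LaurentRing k] SHat k)) m, ← map_mul, inv_mul_cancel₀ hm, map_one]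
    · exact Finset.mem_range.2 (Nat.pos_of_ne_zero (NeZero.ne m))
    · intro a ha h0
      -- The same orthogonality with the roles exchanged: the exponent `a` is compared with `0`, and
      -- the summation runs over the components.
      have hsum := geom_sum_eq_ite (Z.primitive m NeZero.one_le)
        (Nat.pos_of_ne_zero (NeZero.ne m)) (Finset.mem_range.1 ha)
      rw [if_neg h0] at hsum
      simp only [mul_pow, ← map_pow]
      rw [← Finset.sum_mul, ← mul_assoc, ← map_sum, ← map_mul]
      simp only [pow_zero, mul_one] at hsum
      simp only [← pow_mul, mul_comm _ a] at hsum ⊢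
      rw [hsum, map_zero, zero_mul]

theorem ev_tmul (g : ZHat) (a b : SHat k) :
    (Z.ev g).toAlgHom (a ⊗ₜ b) = a * (Z.gal g).toAlgHom b := rfl

/-- The evaluation at `g` sends `t ^ (-1/m) ⊗ t ^ (1/m)` to `χ(g, 1/m) = ζ_m ^ i`, so it turns the
idempotent into a character sum. Thus `idem m j` is the indicator function of the class `j`. -/
theorem ev_idem (g : ZHat) (m : ℕ) [NeZero m] {i j : ℕ} (hi : i < m) (hj : j < m)
    (hg : ZHat.IsRep g m i) : (Z.ev g).toAlgHom (Z.idem m j) = if j = i then 1 else 0 := by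
  have hu : (Z.ev g).toAlgHom (monomialUnit k (1 / m)) = scalar k _ (Z.ζ m ^ i) := by
    rw [monomialUnit, ev_tmul, gal_single, AddMonoidAlgebra.single_mul_single, neg_add_cancel,
      scalar_sHat, Z.chi_eq g _ m 1 i (by simp) hg]
    simp
  rw [idem, map_mul, map_sum]
  simp only [map_mul, map_pow, map_scalar, hu]
  simp only [← map_mul, ← map_pow, ← map_sum]
  rw [geom_sum_eq_ite (Z.primitive m NeZero.one_le) hi hj]
  split_ifs <;> simp

/-- Up to the left factor, `1 ⊗ t ^ q` is the unit `t ^ (-q) ⊗ t ^ q`. With `q = n + b / m`, this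
unit acts on the component `j` as `ζ_m ^ (b j)`, which is `χ(g, q)`. -/
theorem idem_mul_one_tmul_single (m : ℕ) [NeZero m] (j : ℕ) {g : ZHat} (hg : ZHat.IsRep g m j)
    {q : ℚ} (hq : q.den ∣ m) (c : k) :
    Z.idem m j * (1 ⊗ₜ (AddMonoidAlgebra.single q c : SHat k)) =
      Z.idem m j * ((Z.gal g).toAlgHom (AddMonoidAlgebra.single q c) ⊗ₜ 1) := by
  obtain ⟨n, b, rfl⟩ := exists_eq_add_div hq
  have hs : ∀ c' : k, (AddMonoidAlgebra.single (n + b * (1 / m) : ℚ) (c' * c) : SHat k) ⊗ₜ[LaurentRing k]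
      (1 : SHat k) = scalar k _ c' * ((AddMonoidAlgebra.single (n + b * (1 / m) : ℚ) c : SHat k) ⊗ₜ 1) := by
    intro c'
    rw [← map_scalar (Algebra.TensorProduct.includeLeft : SHat k →ₐ[LaurentRing k] _),
      Algebra.TensorProduct.includeLeft_apply, Algebra.TensorProduct.tmul_mul_tmul, scalar_sHat,
      AddMonoidAlgebra.single_mul_single, zero_add, mul_one]
  rw [one_tmul_single, monomialUnit_add, monomialUnit_intCast, one_mul, gal_single, chi_add,
    chi_intCast, one_mul, Z.chi_eq g _ m b j (by push_cast; ring) hg, hs, mul_left_comm,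
    idem_mul_monomialUnit, mul_left_comm, mul_left_comm (Z.idem m j), mul_comm _ (scalar k _ _)]
  norm_cast
  ring

end CompatibleRoots

/-! ### Functions on `Ẑ` that factor through a finite quotient -/

namespace ZHat

/-- The function `F` on `Ẑ` factors through some finite quotient `ℤ / m`. -/
def FiniteLevel {X : Type*} (F : ZHat → X) : Prop :=
  ∃ (m : ℕ) (_ : NeZero m), ∀ g h n, IsRep g m n → IsRep h m n → F g = F h

namespace FiniteLevel

variable {X Y W : Type*}

theorem const (x : X) : FiniteLevel fun _ => x := ⟨1, inferInstance, fun _ _ _ _ _ => rfl⟩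

theorem comp {F : ZHat → X} (hF : FiniteLevel F) (f : X → Y) : FiniteLevel fun g => f (F g) := by
  obtain ⟨m, hm, h⟩ := hF
  exact ⟨m, hm, fun a b n ha hb => congrArg f (h a b n ha hb)⟩

theorem prodMk {F : ZHat → X} {G : ZHat → Y} (hF : FiniteLevel F) (hG : FiniteLevel G) :
    FiniteLevel fun g => (F g, G g) := by
  obtain ⟨m, hm, h⟩ := hF
  obtain ⟨m', hm', h'⟩ := hG
  refine ⟨m * m', ⟨mul_ne_zero (NeZero.ne m) (NeZero.ne m')⟩, fun a b n ha hb => ?_⟩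
  exact Prod.ext (h a b n (ha.of_dvd (dvd_mul_right _ _)) (hb.of_dvd (dvd_mul_right _ _)))
    (h' a b n (ha.of_dvd (dvd_mul_left _ _)) (hb.of_dvd (dvd_mul_left _ _)))

theorem comp₂ {F : ZHat → X} {G : ZHat → Y} (hF : FiniteLevel F) (hG : FiniteLevel G)
    (f : X → Y → W) : FiniteLevel fun g => f (F g) (G g) :=
  (hF.prodMk hG).comp fun p => f p.1 p.2

/-- Finitely many moduli have a common multiple. The lemma is applied with `s` a set of generators
of `V` and `f g` the values of an automorphism on them. -/
theorem of_eq_on_finset {F : ZHat → X} (s : Finset Y) (f : ZHat → Y → W)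
    (hf : ∀ y ∈ s, FiniteLevel fun g => f g y)
    (h : ∀ g g', (∀ y ∈ s, f g y = f g' y) → F g = F g') : FiniteLevel F := by
  classical
  suffices H : ∀ s : Finset Y, (∀ y ∈ s, FiniteLevel fun g => f g y) →
      ∃ (m : ℕ) (_ : NeZero m), ∀ g g' n, IsRep g m n → IsRep g' m n → ∀ y ∈ s, f g y = f g' y by
    obtain ⟨m, hm, H⟩ := H s hf
    exact ⟨m, hm, fun g g' n hg hg' => h g g' (H g g' n hg hg')⟩
  intro s
  induction s using Finset.induction_on with
  | empty => exact fun _ => ⟨1, inferInstance, by simp⟩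
  | insert y s _ ih =>
    intro hf
    obtain ⟨m, hm, h⟩ := ih fun y hy => hf y (Finset.mem_insert_of_mem hy)
    obtain ⟨m', hm', h'⟩ := hf y (Finset.mem_insert_self _ _)
    refine ⟨m * m', ⟨mul_ne_zero (NeZero.ne m) (NeZero.ne m')⟩, fun a b n ha hb z hz => ?_⟩
    rcases Finset.mem_insert.1 hz with rfl | hz
    · exact h' a b n (ha.of_dvd (dvd_mul_left _ _)) (hb.of_dvd (dvd_mul_left _ _))
    · exact h a b n (ha.of_dvd (dvd_mul_right _ _)) (hb.of_dvd (dvd_mul_right _ _)) z hz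

theorem isLocallyConstant {F : ZHat → X} (hF : FiniteLevel F) : IsLocallyConstant F := by
  obtain ⟨m, hm, h⟩ := hF
  refine (IsLocallyConstant.iff_exists_open F).2 fun g => ?_
  obtain ⟨n, hn⟩ := exists_isRep g m
  exact ⟨_, isOpen_isRep m n, hn, fun g' hg' => h g' g n hg' hn⟩

end FiniteLevel

/-- A continuous cocycle with values in a discrete group factors through a finite quotient. -/
theorem finiteLevel_of_cocycle {A : Type*} [Group A] [TopologicalSpace A] [DiscreteTopology A]
    {ρ : ZHat →* MulAut A} (c : ContZ1 ρ) : FiniteLevel c.1 := by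
  have h1 : c.1 1 = 1 := by simpa using c.2.2 1 1
  obtain ⟨m, hm, h⟩ := exists_isRep_zero_subset ((isOpen_discrete {(1 : A)}).preimage c.2.1) h1
  refine ⟨m, hm, fun a b n ha hb => ?_⟩
  -- Near the identity `c` is trivial; the cocycle identity for `b = a (a⁻¹ b)` spreads this to all
  -- cosets.
  have hab : c.1 (a⁻¹ * b) = 1 := h _ (by simpa using ha.inv.mul hb)
  have := c.2.2 a (a⁻¹ * b)
  rw [mul_inv_cancel_left, hab, map_one, mul_one] at this
  exact this.symm

end ZHat

/-! ### Finite generation and continuity of the action -/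

namespace CompatibleRoots

open ZHat

variable {k : Type*} [Field k] [CharZero k] (Z : CompatibleRoots k)

theorem finiteLevel_gal (s : SHat k) : FiniteLevel fun g => (Z.gal g).toAlgHom s := by
  induction s using AddMonoidAlgebra.induction_linear with
  | zero => simpa using FiniteLevel.const 0
  | add x y hx hy => simpa using hx.comp₂ hy (· + ·)
  | single q a =>
    refine ⟨q.den, inferInstance, fun g h n hg hh => ?_⟩
    beta_reduce
    rw [gal_single, gal_single, Z.chi_eq g q q.den q.num n (Rat.num_div_den q).symm hg,
      Z.chi_eq h q q.den q.num n (Rat.num_div_den q).symm hh]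

theorem finiteLevel_ev (x : SHat k ⊗[LaurentRing k] SHat k) :
    FiniteLevel fun g => (Z.ev g).toAlgHom x := by
  induction x with
  | zero => simpa using FiniteLevel.const 0
  | add x y hx hy => simpa using hx.comp₂ hy (· + ·)
  | tmul a b => exact (Z.finiteLevel_gal b).comp (a * ·)

variable {V : Type*} [AddCommGroup V] [VertexRing V] [VertexAlgebra (LaurentRing k) V]
  {𝓕 : VertexFiltration (LaurentRing k) V}

section Map

variable {T U : Type*} [CommRing T] [HasseSchmidt T] [Algebra (LaurentRing k) T]
  [HSAlgebra (LaurentRing k) T] [CommRing U] [HasseSchmidt U] [Algebra (LaurentRing k) U]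
  [HSAlgebra (LaurentRing k) U]

theorem finiteLevel_push {f : ZHat → HSHom (LaurentRing k) T U}
    (hf : ∀ t, FiniteLevel fun g => (f g).toAlgHom t) (x : T ⊗[LaurentRing k] V) :
    FiniteLevel fun g => VAut.push V (f g) x := by
  induction x with
  | zero => simpa using FiniteLevel.const 0
  | add x y hx hy => simpa using hx.comp₂ hy (· + ·)
  | tmul t v => exact (hf t).comp (· ⊗ₜ v)

/-- By `VAut.ext_of_generators` only the images of finitely many generators matter, and each of
these has finite level. It is used for `gal`, giving continuity of the action, and for `ev`, giving
continuity of the cocycles. -/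
theorem finiteLevel_map (hV : VertexAlgebra.FinitelyGenerated (LaurentRing k) V)
    {f : ZHat → HSHom (LaurentRing k) T U}
    (hf : ∀ t, FiniteLevel fun g => (f g).toAlgHom t) (h : VAut 𝓕 T) :
    FiniteLevel fun g => VAut.map (f g) h := by
  obtain ⟨s, hs⟩ := hV
  refine FiniteLevel.of_eq_on_finset s (fun g v => VAut.push V (f g) (h.equiv (1 ⊗ₜ v)))
    (fun v _ => finiteLevel_push hf _) fun g g' H => VAut.ext_of_generators hs fun v hv => ?_
  rw [VAut.map_equiv_one_tmul, VAut.map_equiv_one_tmul]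
  exact H v hv

end Map

instance (T : Type*) [CommRing T] [HasseSchmidt T] [Algebra (LaurentRing k) T]
    [HSAlgebra (LaurentRing k) T] : DiscreteTopology (VAut 𝓕 T) := ⟨rfl⟩

theorem autAction_apply (g : ZHat) (h : VAut 𝓕 (SHat k)) :
    Z.autAction 𝓕 g h = VAut.map (Z.gal g) h := rfl

theorem continuous_autAction (hV : VertexAlgebra.FinitelyGenerated (LaurentRing k) V) :
    Continuous fun p : ZHat × VAut 𝓕 (SHat k) => Z.autAction 𝓕 p.1 p.2 :=
  continuous_prod_of_discrete_right.2 fun h =>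
    (finiteLevel_map hV Z.finiteLevel_gal h).isLocallyConstant.continuous

/-! ### Joint injectivity of the evaluations -/

section JointlyInjective

variable {A : Type*} [CommRing A] [HasseSchmidt A] [Algebra (LaurentRing k) A]
  [HSAlgebra (LaurentRing k) A] (f : HSHom (LaurentRing k) (SHat k) A)

/-- The map `A ⊗ Ŝ → A`, `a ⊗ s ↦ a f(g(s))`. -/
def evAlong (g : ZHat) : HSHom (LaurentRing k) (A ⊗[LaurentRing k] SHat k) A :=
  HSHom.productMap (HSHom.id (LaurentRing k) A) (f.comp (Z.gal g))

theorem evAlong_tmul (g : ZHat) (a : A) (s : SHat k) :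
    (Z.evAlong f g).toAlgHom (a ⊗ₜ s) = a * f.toAlgHom ((Z.gal g).toAlgHom s) := rfl

/-- The map `f ⊗ id : Ŝ ⊗ Ŝ → A ⊗ Ŝ`. -/
def extendLeft : HSHom (LaurentRing k) (SHat k ⊗[LaurentRing k] SHat k)
    (A ⊗[LaurentRing k] SHat k) :=
  HSHom.productMap ((HSHom.inl (LaurentRing k) A (SHat k)).comp f)
    (HSHom.inr (LaurentRing k) A (SHat k))

theorem extendLeft_tmul (a s : SHat k) :
    (extendLeft f).toAlgHom (a ⊗ₜ s) = f.toAlgHom a ⊗ₜ s := by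
  change (f.toAlgHom a ⊗ₜ[LaurentRing k] (1 : SHat k)) * ((1 : A) ⊗ₜ s) = _
  rw [Algebra.TensorProduct.tmul_mul_tmul, mul_one, one_mul]

/-- By additivity this reduces to `idem_mul_one_tmul_single`, transported to `A ⊗ Ŝ` along `f`. The
level `m₀` is a common denominator of the exponents in `x`; allowing all its multiples is what lets
sums be treated at a common level. The general `A` serves both the double and the triple tensor
product. -/
theorem exists_idem_mul_eq (x : A ⊗[LaurentRing k] SHat k) :
    ∃ m₀ ≠ 0, ∀ (m : ℕ) [NeZero m], m₀ ∣ m → ∀ (j : ℕ) (g : ZHat), IsRep g m j →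
      (extendLeft f).toAlgHom (Z.idem m j) * x =
        (extendLeft f).toAlgHom (Z.idem m j) * ((Z.evAlong f g).toAlgHom x ⊗ₜ 1) := by
  induction x with
  | zero => exact ⟨1, one_ne_zero, fun m _ _ j g _ => by simp⟩
  | add x y hx hy =>
    obtain ⟨m₀, h0, h⟩ := hx
    obtain ⟨m₁, h0', h'⟩ := hy
    refine ⟨m₀ * m₁, mul_ne_zero h0 h0', fun m _ hm j g hg => ?_⟩
    rw [map_add, TensorProduct.add_tmul, mul_add, mul_add,
      h m (dvd_of_mul_right_dvd hm) j g hg, h' m (dvd_of_mul_left_dvd hm) j g hg]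
  | tmul a s =>
    induction s using AddMonoidAlgebra.induction_linear with
    | zero => exact ⟨1, one_ne_zero, fun m _ _ j g _ => by simp⟩
    | add x y hx hy =>
      obtain ⟨m₀, h0, h⟩ := hx
      obtain ⟨m₁, h0', h'⟩ := hy
      refine ⟨m₀ * m₁, mul_ne_zero h0 h0', fun m _ hm j g hg => ?_⟩
      rw [TensorProduct.tmul_add, map_add, TensorProduct.add_tmul, mul_add, mul_add,
        h m (dvd_of_mul_right_dvd hm) j g hg, h' m (dvd_of_mul_left_dvd hm) j g hg]
    | single q c =>
      refine ⟨q.den, q.den_nz, fun m _ hm j g hg => ?_⟩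
      have := congrArg (extendLeft f).toAlgHom (Z.idem_mul_one_tmul_single m j hg hm c)
      rw [map_mul, map_mul, extendLeft_tmul, extendLeft_tmul, map_one] at this
      have h1 : a ⊗ₜ[LaurentRing k] (AddMonoidAlgebra.single q c : SHat k) =
          (a ⊗ₜ 1) * (1 ⊗ₜ AddMonoidAlgebra.single q c) := by simp
      have h2 : ∀ b : A, (a * b) ⊗ₜ[LaurentRing k] (1 : SHat k) = (a ⊗ₜ 1) * (b ⊗ₜ 1) := by simp
      rw [evAlong_tmul, h1, h2, mul_left_comm, this, mul_left_comm]

theorem exists_idem_smul_eq (x : (A ⊗[LaurentRing k] SHat k) ⊗[LaurentRing k] V) :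
    ∃ m₀ ≠ 0, ∀ (m : ℕ) [NeZero m], m₀ ∣ m → ∀ (j : ℕ) (g : ZHat), IsRep g m j →
      (extendLeft f).toAlgHom (Z.idem m j) • x =
        (extendLeft f).toAlgHom (Z.idem m j) •
          VAut.push V (HSHom.inl (LaurentRing k) A (SHat k)) (VAut.push V (Z.evAlong f g) x) := by
  induction x with
  | zero => exact ⟨1, one_ne_zero, fun m _ _ j g _ => by simp⟩
  | add x y hx hy =>
    obtain ⟨m₀, h0, h⟩ := hx
    obtain ⟨m₁, h0', h'⟩ := hy
    refine ⟨m₀ * m₁, mul_ne_zero h0 h0', fun m _ hm j g hg => ?_⟩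
    rw [map_add, map_add, smul_add, smul_add,
      h m (dvd_of_mul_right_dvd hm) j g hg, h' m (dvd_of_mul_left_dvd hm) j g hg]
  | tmul x v =>
    obtain ⟨m₀, h0, h⟩ := Z.exists_idem_mul_eq f x
    refine ⟨m₀, h0, fun m _ hm j g hg => ?_⟩
    rw [VAut.push_tmul, VAut.push_tmul, TensorProduct.smul_tmul', TensorProduct.smul_tmul',
      smul_eq_mul, smul_eq_mul, h m hm j g hg]
    rfl

/-- At a level adapted to `x - y`, each component of `x - y` is recovered from its evaluation at
`gen ^ j`, hence vanishes; the components add up to `x - y`. -/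
theorem eq_of_push_evAlong_eq {x y : (A ⊗[LaurentRing k] SHat k) ⊗[LaurentRing k] V}
    (h : ∀ g, VAut.push V (Z.evAlong f g) x = VAut.push V (Z.evAlong f g) y) : x = y := by
  obtain ⟨m, h0, H⟩ := Z.exists_idem_smul_eq f (x - y)
  have : NeZero m := ⟨h0⟩
  have hs := congrArg (extendLeft f).toAlgHom (Z.completeOrthogonalIdempotents_idem m).complete
  rw [map_one, map_sum] at hs
  rw [← sub_eq_zero, ← one_smul (A ⊗[LaurentRing k] SHat k) (x - y), ← hs, Finset.sum_smul]
  refine Finset.sum_eq_zero fun j _ => ?_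
  rw [H m dvd_rfl j (ZHat.gen ^ (j : ℕ)) (isRep_gen_pow m j), map_sub, h, sub_self, map_zero,
    smul_zero]

theorem vAut_eq_of_map_evAlong_eq {φ ψ : VAut 𝓕 (A ⊗[LaurentRing k] SHat k)}
    (h : ∀ g, VAut.map (Z.evAlong f g) φ = VAut.map (Z.evAlong f g) ψ) : φ = ψ := by
  refine VAut.ext_one_tmul fun v => Z.eq_of_push_evAlong_eq f fun g => ?_
  rw [← VAut.map_equiv_one_tmul, ← VAut.map_equiv_one_tmul, h]

end JointlyInjective

theorem vAut_eq_of_map_ev_eq {φ ψ : VAut 𝓕 (SHat k ⊗[LaurentRing k] SHat k)}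
    (h : ∀ g, VAut.map (Z.ev g) φ = VAut.map (Z.ev g) ψ) : φ = ψ :=
  Z.vAut_eq_of_map_evAlong_eq (HSHom.id _ _) h

/-! ### Comparison of descent cocycles with Galois cocycles -/

theorem hsHom_eq_of_toAlgHom_eq {A B : Type*} [CommRing A] [HasseSchmidt A] [Algebra (LaurentRing k) A]
    [CommRing B] [HasseSchmidt B] [Algebra (LaurentRing k) B]
    {f f' : HSHom (LaurentRing k) A B} (h : f.toAlgHom = f'.toAlgHom) : f = f' := by
  cases f
  cases f'
  simp only at h
  subst h
  rfl

theorem ev_comp_inl (g : ZHat) :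
    (Z.ev g).comp (HSHom.inl (LaurentRing k) (SHat k) (SHat k)) = HSHom.id _ _ :=
  hsHom_eq_of_toAlgHom_eq <| AlgHom.ext fun a => by
    change a * (Z.gal g).toAlgHom 1 = a
    rw [map_one, mul_one]

theorem ev_comp_inr (g : ZHat) :
    (Z.ev g).comp (HSHom.inr (LaurentRing k) (SHat k) (SHat k)) = Z.gal g :=
  hsHom_eq_of_toAlgHom_eq <| AlgHom.ext fun _ => one_mul _

/-- The map `Ŝ ⊗ Ŝ ⊗ Ŝ → Ŝ`, `a ⊗ b ⊗ c ↦ a g(b) gh(c)`. -/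
def ev₂ (g h : ZHat) : HSHom (LaurentRing k)
    ((SHat k ⊗[LaurentRing k] SHat k) ⊗[LaurentRing k] SHat k) (SHat k) :=
  (Z.ev g).comp (Z.evAlong (HSHom.inl (LaurentRing k) (SHat k) (SHat k)) (g * h))

theorem ev₂_tmul (g h : ZHat) (a b c : SHat k) : (Z.ev₂ g h).toAlgHom ((a ⊗ₜ b) ⊗ₜ c) =
    a * (Z.gal g).toAlgHom b * (Z.gal (g * h)).toAlgHom c := by
  change (Z.ev g).toAlgHom ((a ⊗ₜ b) * ((Z.gal (g * h)).toAlgHom c ⊗ₜ 1)) = _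
  rw [map_mul, ev_tmul, ev_tmul, map_one, mul_one]

theorem ev₂_comp_p12 (g h : ZHat) :
    (Z.ev₂ g h).comp (p12 (LaurentRing k) (SHat k)) = Z.ev g :=
  hsHom_eq_of_toAlgHom_eq <| Algebra.TensorProduct.ext' fun a b => by
    change (Z.ev₂ g h).toAlgHom ((a ⊗ₜ b) ⊗ₜ 1) = _
    rw [ev₂_tmul, map_one, mul_one, ev_tmul]

theorem ev₂_comp_p13 (g h : ZHat) :
    (Z.ev₂ g h).comp (p13 (LaurentRing k) (SHat k)) = Z.ev (g * h) :=
  hsHom_eq_of_toAlgHom_eq <| Algebra.TensorProduct.ext' fun a b => by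
    change (Z.ev₂ g h).toAlgHom (((a ⊗ₜ 1) ⊗ₜ 1) * ((1 ⊗ₜ 1) ⊗ₜ b)) = _
    rw [map_mul, ev₂_tmul, ev₂_tmul, ev_tmul]
    simp only [map_one, mul_one, one_mul]

theorem ev₂_comp_p23 (g h : ZHat) :
    (Z.ev₂ g h).comp (p23 (LaurentRing k) (SHat k)) = (Z.gal g).comp (Z.ev h) :=
  hsHom_eq_of_toAlgHom_eq <| Algebra.TensorProduct.ext' fun a b => by
    change (Z.ev₂ g h).toAlgHom (((1 ⊗ₜ a) ⊗ₜ 1) * ((1 ⊗ₜ 1) ⊗ₜ b)) =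
      (Z.gal g).toAlgHom ((Z.ev h).toAlgHom (a ⊗ₜ b))
    rw [map_mul, ev₂_tmul, ev₂_tmul, ev_tmul, map_mul, gal_mul]
    simp only [map_one, mul_one, one_mul]
    rfl

theorem vAut_eq_of_map_ev₂_eq
    {φ ψ : VAut 𝓕 ((SHat k ⊗[LaurentRing k] SHat k) ⊗[LaurentRing k] SHat k)}
    (H : ∀ g h, VAut.map (Z.ev₂ g h) φ = VAut.map (Z.ev₂ g h) ψ) : φ = ψ := by
  refine Z.vAut_eq_of_map_evAlong_eq (HSHom.inl _ _ _) fun g => Z.vAut_eq_of_map_ev_eq fun h => ?_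
  -- The last tensor factor is evaluated at `g` first, then the remaining two at `h`. As `ev₂ h h'`
  -- evaluates the last factor at `h h'`, the second argument must be `h⁻¹ g`.
  have := H h (h⁻¹ * g)
  rw [ev₂, mul_inv_cancel_left, VAut.map_comp, VAut.map_comp] at this
  exact this

/-- The descent condition may be tested after all `ev₂ g h`. These restrict along `p12`, `p13`,
`p23` to `ev g`, `ev (g h)` and `ev h` followed by `g`; the last one produces the twist by the
action. -/
theorem isCocycle_iff (φ : VAut 𝓕 (SHat k ⊗[LaurentRing k] SHat k)) :
    VAut.map (p13 (LaurentRing k) (SHat k)) φ =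
        VAut.map (p12 (LaurentRing k) (SHat k)) φ * VAut.map (p23 (LaurentRing k) (SHat k)) φ ↔
      ∀ g h, VAut.map (Z.ev (g * h)) φ =
        VAut.map (Z.ev g) φ * Z.autAction 𝓕 g (VAut.map (Z.ev h) φ) := by
  have key : ∀ g h, VAut.map (Z.ev₂ g h) (VAut.map (p12 (LaurentRing k) (SHat k)) φ *
      VAut.map (p23 (LaurentRing k) (SHat k)) φ) =
        VAut.map (Z.ev g) φ * Z.autAction 𝓕 g (VAut.map (Z.ev h) φ) := fun g h => by
    rw [map_mul, ← VAut.map_comp, ← VAut.map_comp, ev₂_comp_p12, ev₂_comp_p23, VAut.map_comp,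
      autAction_apply]
  constructor
  · intro H g h
    rw [← key, ← H, ← VAut.map_comp, ev₂_comp_p13]
  · intro H
    refine Z.vAut_eq_of_map_ev₂_eq fun g h => ?_
    rw [key, ← H, ← VAut.map_comp, ev₂_comp_p13]

/-- The continuous cocycle `g ↦ Aut(V)(ev_g)(φ)`. -/
def toContZ1 (hV : VertexAlgebra.FinitelyGenerated (LaurentRing k) V) (φ : FlatZ1 𝓕 (SHat k)) :
    ContZ1 (Z.autAction 𝓕) :=
  ⟨fun g => VAut.map (Z.ev g) φ.1,
    (finiteLevel_map hV Z.finiteLevel_ev φ.1).isLocallyConstant.continuous,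
    (Z.isCocycle_iff φ.1).1 φ.2⟩

/-- On the component `j` one places the value of `c` on the class `j`, extended from the left
factor. Evaluation at `g` selects the class of `g` and restricts to the identity on the left factor.
No cocycle condition is involved. -/
theorem exists_map_ev_eq {c : ZHat → VAut 𝓕 (SHat k)} (hc : FiniteLevel c) :
    ∃ φ : VAut 𝓕 (SHat k ⊗[LaurentRing k] SHat k), ∀ g, VAut.map (Z.ev g) φ = c g := by
  obtain ⟨m, hm, h⟩ := hc
  refine ⟨VAut.glue (Z.completeOrthogonalIdempotents_idem m) fun j =>
    VAut.map (HSHom.inl (LaurentRing k) (SHat k) (SHat k)) (c (ZHat.gen ^ (j : ℕ))), fun g => ?_⟩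
  obtain ⟨i, hi, hg⟩ := exists_isRep_gen_pow g m
  rw [VAut.map_glue _ _ _ ⟨i, hi⟩ fun j => by
      rw [Z.ev_idem g m hi j.2 hg]; simp only [Fin.ext_iff],
    ← VAut.map_comp, ev_comp_inl, VAut.map_id]
  exact h _ _ _ (isRep_gen_pow m i) hg

theorem bijective_toContZ1 (hV : VertexAlgebra.FinitelyGenerated (LaurentRing k) V) :
    Function.Bijective (Z.toContZ1 (𝓕 := 𝓕) hV) := by
  constructor
  · intro φ ψ h
    exact Subtype.ext (Z.vAut_eq_of_map_ev_eq fun g => congrFun (congrArg Subtype.val h) g)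
  · intro c
    obtain ⟨φ, hφ⟩ := Z.exists_map_ev_eq (finiteLevel_of_cocycle c)
    refine ⟨⟨φ, (Z.isCocycle_iff φ).2 fun g h => ?_⟩, Subtype.ext (funext hφ)⟩
    rw [hφ, hφ, hφ, c.2.2]

theorem flatSetoid_iff_contSetoid (hV : VertexAlgebra.FinitelyGenerated (LaurentRing k) V)
    (φ ψ : FlatZ1 𝓕 (SHat k)) : (flatSetoid 𝓕 (SHat k)) φ ψ ↔
      (contSetoid (Z.autAction 𝓕)) (Z.toContZ1 hV φ) (Z.toContZ1 hV ψ) := by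
  -- The same `a` witnesses both relations, since `ev g` restricts to the identity on the left
  -- factor and to `g` on the right one.
  refine exists_congr fun a => ?_
  have key : ∀ g, VAut.map (Z.ev g)
      ((VAut.map (HSHom.inl (LaurentRing k) (SHat k) (SHat k)) a)⁻¹ * φ.1 *
        VAut.map (HSHom.inr (LaurentRing k) (SHat k) (SHat k)) a) =
      a⁻¹ * VAut.map (Z.ev g) φ.1 * Z.autAction 𝓕 g a := fun g => by
    rw [map_mul, map_mul, map_inv, ← VAut.map_comp, ← VAut.map_comp, ev_comp_inl, ev_comp_inr,
      VAut.map_id, autAction_apply]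
  constructor
  · intro h g
    change VAut.map (Z.ev g) ψ.1 = _
    rw [h, key]
    rfl
  · intro h
    exact Z.vAut_eq_of_map_ev_eq fun g => (h g).trans (key g).symm

end CompatibleRoots

end

theorem mainTheorem10 (k : Type*) [Field k] [CharZero k] (Z : CompatibleRoots k)
    (V : Type*) [AddCommGroup V] [VertexRing V] [VertexAlgebra (LaurentRing k) V]
    (𝓕 : VertexFiltration (LaurentRing k) V)
    (hV : VertexAlgebra.FinitelyGenerated (LaurentRing k) V) :
    Continuous (fun p : ZHat × VAut 𝓕 (SHat k) => Z.autAction 𝓕 p.1 p.2) ∧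
    ∃ e : FlatH1 𝓕 (SHat k) ≃ ContH1 (Z.autAction 𝓕),
      e (FlatH1.mk 𝓕 (SHat k) 1) = ContH1.mk (Z.autAction 𝓕) 1 ∧
      ∀ φ : FlatZ1 𝓕 (SHat k), ∃ c : ContZ1 (Z.autAction 𝓕),
        (∀ g : ZHat, c.1 g = VAut.map (Z.ev g) φ.1) ∧
        e (FlatH1.mk 𝓕 (SHat k) φ) = ContH1.mk (Z.autAction 𝓕) c := by
  refine ⟨Z.continuous_autAction hV,
    Quotient.congr (Equiv.ofBijective _ (Z.bijective_toContZ1 hV))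
      (Z.flatSetoid_iff_contSetoid hV), ?_, fun φ => ⟨Z.toContZ1 hV φ, fun _ => rfl, rfl⟩⟩
  refine congrArg (ContH1.mk (Z.autAction 𝓕)) (Subtype.ext (funext fun g => ?_))
  exact map_one (VAut.map (Z.ev g))
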